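/- Let the bull be the triangle with one pendant vertex attached to each of two of its vertices, and let $\mathsf{E}$ be the path on five vertices with one pendant vertex attached to its middle vertex. A graph is $(\mathrm{bull},\mathsf{E})$-free if it contains neither of these graphs as an induced subgraph. An instance of List $k$-Coloring consists of a finite simple graph $G$ and a list $L(v)\subseteq\{1,\dots,k\}$ for each vertex $v$; the task is to find a proper coloring $c$ of $G$ with $c(v)\in L(v)$ for all vertices $v$, or to report that there is none. There is an absolute constant $C$ such that for every $k\ge 3$ there is a unit-cost random access machine program (with addition, truncated subtraction, indirect addressing, conditionals and loops) that halts on every instance $(G,L)$ of List $k$-Coloring whose graph $G$ is $(\mathrm{bull},\mathsf{E})$-free, solves it correctly, and, if $G$ has $n\ge 2$ vertices, does so in at most $n^{C k^2\log_2 n}$ steps. In other words, for every $k\ge 3$, List $k$-Coloring on $n$-vertex $(\mathrm{bull},\mathsf{E})$-free graphs can be solved in time $n^{\mathcal{O}(k^2\log n)}$. Here $G$ is given by its adjacency matrix and $L$ by the 0/1 vertex-color incidence matrix. -/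

import Mathlib

/-! ### Random access machines with unit cost

The machine has registers `reg 0, reg 1, ...` (a program mentions only finitely many of them) and a
memory `mem 0, mem 1, ...`; each of these cells holds a natural number. The arithmetic operations
are addition and truncated subtraction; there is no multiplication or shift. Programs are finite
and are written in structured form. -/

namespace RAM

/-- The content of the registers and of the memory. -/
structure State where
  reg : ℕ → ℕ
  mem : ℕ → ℕ

/-- Assign the value `x` to register `i`. -/
def State.setReg (s : State) (i x : ℕ) : State :=
  { s with reg := Function.update s.reg i x }

/-- Write the value `x` into the memory cell with address `a`. -/
def State.setMem (s : State) (a x : ℕ) : State :=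
  { s with mem := Function.update s.mem a x }

/-- Structured RAM programs. -/
inductive Prog : Type
  /-- do nothing -/
  | skip : Prog
  /-- `reg i := c` -/
  | const (i c : ℕ) : Prog
  /-- `reg i := reg j + reg l` -/
  | add (i j l : ℕ) : Prog
  /-- `reg i := max (reg j - reg l) 0` -/
  | sub (i j l : ℕ) : Prog
  /-- `reg i := mem (reg j)` -/
  | load (i j : ℕ) : Prog
  /-- `mem (reg i) := reg j` -/
  | store (i j : ℕ) : Prog
  /-- run the first program, then the second one -/
  | seq (P Q : Prog) : Prog
  /-- if `reg i ≠ 0` then run the first program, else run the second one -/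
  | ite (i : ℕ) (P Q : Prog) : Prog
  /-- while `reg i ≠ 0`, run the program -/
  | loop (i : ℕ) (P : Prog) : Prog

/-- `Exec P s t s'`: started in state `s`, the program `P` halts in state `s'` after exactly `t`
steps. Every elementary instruction and every test of a condition takes one step. -/
inductive Exec : Prog → State → ℕ → State → Prop
  | skip (s : State) : Exec .skip s 1 s
  | const (i c : ℕ) (s : State) : Exec (.const i c) s 1 (s.setReg i c)
  | add (i j l : ℕ) (s : State) : Exec (.add i j l) s 1 (s.setReg i (s.reg j + s.reg l))
  | sub (i j l : ℕ) (s : State) : Exec (.sub i j l) s 1 (s.setReg i (s.reg j - s.reg l))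
  | load (i j : ℕ) (s : State) : Exec (.load i j) s 1 (s.setReg i (s.mem (s.reg j)))
  | store (i j : ℕ) (s : State) : Exec (.store i j) s 1 (s.setMem (s.reg i) (s.reg j))
  | seq {P Q : Prog} {s s' s'' : State} {t t' : ℕ} :
      Exec P s t s' → Exec Q s' t' s'' → Exec (.seq P Q) s (t + t') s''
  | ite_true {i : ℕ} {P Q : Prog} {s s' : State} {t : ℕ} :
      s.reg i ≠ 0 → Exec P s t s' → Exec (.ite i P Q) s (t + 1) s'
  | ite_false {i : ℕ} {P Q : Prog} {s s' : State} {t : ℕ} :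
      s.reg i = 0 → Exec Q s t s' → Exec (.ite i P Q) s (t + 1) s'
  | loop_true {i : ℕ} {P : Prog} {s s' s'' : State} {t t' : ℕ} :
      s.reg i ≠ 0 → Exec P s t s' → Exec (.loop i P) s' t' s'' →
        Exec (.loop i P) s (t + t' + 1) s''
  | loop_false {i : ℕ} {P : Prog} {s : State} :
      s.reg i = 0 → Exec (.loop i P) s 1 s

end RAM

namespace ListColoring

/-- The bull: the triangle `0, 1, 2` with a pendant vertex `3` at `0` and a pendant vertex `4`
at `1`. -/
def bull : SimpleGraph (Fin 5) :=
  SimpleGraph.fromEdgeSet {s(0, 1), s(1, 2), s(0, 2), s(0, 3), s(1, 4)}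

/-- The graph `E`: the path `0, 1, 2, 3, 4` with a pendant vertex `5` at its middle vertex `2`. -/
def graphE : SimpleGraph (Fin 6) :=
  SimpleGraph.fromEdgeSet {s(0, 1), s(1, 2), s(2, 3), s(3, 4), s(2, 5)}

/-- `G` is (bull, E)-free: neither graph is isomorphic to an induced subgraph of `G`. -/
def IsBullEFree {V : Type*} (G : SimpleGraph V) : Prop :=
  ¬ bull.IsIndContained G ∧ ¬ graphE.IsIndContained G

/-- `c` is a proper coloring of `G` that gives each vertex a color from its list. -/
def IsListColoring {V : Type*} {k : ℕ} (G : SimpleGraph V) (L : V → Finset (Fin k))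
    (c : V → Fin k) : Prop :=
  (∀ u v, G.Adj u v → c u ≠ c v) ∧ ∀ v, c v ∈ L v

open Classical in
/-- The memory that holds an instance `(G, L)` of List `k`-Coloring on the vertices `0, ..., n - 1`
with the colors `0, ..., k - 1`: cell `0` holds the number `n`, the next `n * n` cells hold the
adjacency matrix row by row, the next `n * k` cells hold the incidence matrix of the lists
row by row, and all other cells are `0`. -/
noncomputable def inputMem {n k : ℕ} (G : SimpleGraph (Fin n)) (L : Fin n → Finset (Fin k)) :
    ℕ → ℕ := fun a =>
  if a = 0 then n
  else if (∃ u v : Fin n, a = 1 + n * u + v ∧ G.Adj u v) ∨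
      (∃ (v : Fin n) (c : Fin k), a = 1 + n * n + k * v + c ∧ c ∈ L v) then 1
  else 0

/-- The initial state on the instance `(G, L)`: all registers are `0`. -/
noncomputable def input {n k : ℕ} (G : SimpleGraph (Fin n)) (L : Fin n → Finset (Fin k)) :
    RAM.State where
  reg := fun _ => 0
  mem := inputMem G L

/-- The state `s` reports a correct answer for `(G, L)`: either memory cell `0` holds `1` and the
cells `1, ..., n` hold a list coloring, or `(G, L)` has no list coloring and cell `0` holds `0`. -/
def IsCorrectOutput {n k : ℕ} (G : SimpleGraph (Fin n)) (L : Fin n → Finset (Fin k))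
    (s : RAM.State) : Prop :=
  (∃ c : Fin n → Fin k, IsListColoring G L c ∧ s.mem 0 = 1 ∧ ∀ v : Fin n, s.mem (1 + v) = c v) ∨
  ((¬ ∃ c : Fin n → Fin k, IsListColoring G L c) ∧ s.mem 0 = 0)

end ListColoring

/-! A negative instance has a refutation of small depth, and closing a table under local rules finds
every refutation of that depth without knowing its shape.

Structure. By the Gyárfás path argument, every vertex set S contains at most four vertices whose
closed neighborhoods meet every connected subset with more than half of S
(`IsBullEFree.exists_separator`). The path may be long, but a vertex that sees it and also sees a
vertex far from it must see one of its ends (`IsBullEFree.adj_end`), so the two ends do the work of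
the whole path. Moreover, for a vertex v and a color c, giving c to at most two nonneighbors of v
suffices to leave no edge between the neighbors and the nonneighbors of v whose two ends may both
take c (`IsBullEFree.refutable_of_separated`).

Depth. Only decisions "v gets c" are counted; decisions "v does not get c" are free. With d colors,
coloring the separator and separating each of its vertices in every color costs at most 4(2d + 1) ≤
12d decisions. The set then splits into parts without conflicts between them: the separator
vertices, their neighborhoods, each of which has lost a color, and connected pieces with at most
half of the vertices. If the set is uncolorable, so is one of the parts, and refuting that part is
enough. For at most 2^a vertices the depth therefore satisfies f(a, d) ≤ max(f(a - 1, d), f(a, d -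
1)) + 12d, which gives 12d(a + d) (`IsBullEFree.refutable_of_not_colorableOn`).

Algorithm. A list of assignments is a number in base b = (n + 1)k. A table of length B = b^(r + 1)
marks lists that cannot be extended to a coloring. The rules are sound, and a closed table detects
every refutation of depth r (`refuted_zero_iff`). A coloring is found by self-reduction, deleting
list entries as long as the instance stays colorable. The running time is at most B^7; with r =
O(k(log n + k)) this is n^O(k² log n). Instances with n < k use the trivial depth r = n instead. -/

namespace ListColoring

/-! ### Forbidden configurations in (bull, E)-free graphs -/

section Structure

variable {V : Type*} {G : SimpleGraph V}

/-- Neither forbidden graph has two vertices with the same neighborhood, so a map that preserves and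
reflects adjacency is automatically injective; distinctness of the images never has to be checked.
-/
theorem isIndContained_of_forall_adj {W : Type*} {H : SimpleGraph W} (f : W → V)
    (hf : ∀ i j, G.Adj (f i) (f j) ↔ H.Adj i j)
    (hH : ∀ i j, (∀ l, H.Adj i l ↔ H.Adj j l) → i = j) : H.IsIndContained G :=
  ⟨⟨⟨f, fun i j hij => hH i j fun l => by rw [← hf, ← hf, hij]⟩, hf _ _⟩⟩

theorem IsBullEFree.bull_false (h : IsBullEFree G) {a b c d e : V}
    (hab : G.Adj a b) (hbc : G.Adj b c) (hac : G.Adj a c) (had : G.Adj a d) (hbe : G.Adj b e)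
    (hae : ¬ G.Adj a e) (hbd : ¬ G.Adj b d) (hcd : ¬ G.Adj c d) (hce : ¬ G.Adj c e)
    (hde : ¬ G.Adj d e) : False := by
  have hs : ∀ {x y : V}, ¬ G.Adj x y → ¬ G.Adj y x := fun h h' => h h'.symm
  refine h.1 (isIndContained_of_forall_adj ![a, b, c, d, e] ?_ ?_)
  · intro i j
    fin_cases i <;> fin_cases j <;>
      simp [bull, hab, hbc, hac, had, hbe, hae, hbd, hcd, hce, hde, hab.symm, hbc.symm, hac.symm,
        had.symm, hbe.symm, hs hae, hs hbd, hs hcd, hs hce, hs hde]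
  · simp only [bull, SimpleGraph.fromEdgeSet_adj, Set.mem_insert_iff, Set.mem_singleton_iff]
    decide

theorem IsBullEFree.graphE_false (h : IsBullEFree G) {a b c d e f : V}
    (hab : G.Adj a b) (hbc : G.Adj b c) (hcd : G.Adj c d) (hde : G.Adj d e) (hcf : G.Adj c f)
    (hac : ¬ G.Adj a c) (had : ¬ G.Adj a d) (hae : ¬ G.Adj a e) (haf : ¬ G.Adj a f)
    (hbd : ¬ G.Adj b d) (hbe : ¬ G.Adj b e) (hbf : ¬ G.Adj b f) (hce : ¬ G.Adj c e)
    (hdf : ¬ G.Adj d f) (hef : ¬ G.Adj e f) : False := by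
  have hs : ∀ {x y : V}, ¬ G.Adj x y → ¬ G.Adj y x := fun h h' => h h'.symm
  refine h.2 (isIndContained_of_forall_adj ![a, b, c, d, e, f] ?_ ?_)
  · intro i j
    fin_cases i <;> fin_cases j <;>
      simp [graphE, hab, hbc, hcd, hde, hcf, hac, had, hae, haf, hbd, hbe, hbf, hce, hdf, hef,
        hab.symm, hbc.symm, hcd.symm, hde.symm, hcf.symm, hs hac, hs had, hs hae, hs haf, hs hbd,
        hs hbe, hs hbf, hs hce, hs hdf, hs hef]
  · simp only [graphE, SimpleGraph.fromEdgeSet_adj, Set.mem_insert_iff, Set.mem_singleton_iff]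
    decide

/-- The configuration that prevents a third nonneighbor of `v` from having a private neighbor
in the neighborhood of `v`. -/
theorem IsBullEFree.no_third_private (h : IsBullEFree G) {v x₁ x₂ x₃ y₁ y₂ y₃ : V}
    (hx₁ : G.Adj v x₁) (hx₂ : G.Adj v x₂) (hx₃ : G.Adj v x₃)
    (hy₁ : ¬ G.Adj v y₁) (hy₂ : ¬ G.Adj v y₂) (hy₃ : ¬ G.Adj v y₃)
    (h₁₂ : ¬ G.Adj y₁ y₂) (h₂₃ : ¬ G.Adj y₂ y₃)
    (h11 : G.Adj x₁ y₁) (h12 : ¬ G.Adj x₁ y₂)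
    (h22 : G.Adj x₂ y₂) (h21 : ¬ G.Adj x₂ y₁) (h23 : ¬ G.Adj x₂ y₃)
    (h33 : G.Adj x₃ y₃) (h31 : ¬ G.Adj x₃ y₁) (h32 : ¬ G.Adj x₃ y₂) : False := by
  -- Any edge among the three neighbors of `v` completes a bull. Once they are independent, the path
  -- y₁, x₁, v, x₂, y₂ with `x₃` pendant at `v` is an induced E.
  have a23 : ¬ G.Adj x₂ x₃ := fun ha =>
    h.bull_false ha hx₃.symm hx₂.symm h22 h33 h23 h32 hy₂ hy₃ h₂₃
  have a12 : ¬ G.Adj x₁ x₂ := fun ha =>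
    h.bull_false ha hx₂.symm hx₁.symm h11 h22 h12 h21 hy₁ hy₂ h₁₂
  have a13 : ¬ G.Adj x₁ x₃ := fun ha =>
    h.bull_false hx₁ ha hx₃ hx₂ h11 hy₁ a12 (fun h' => a23 h'.symm) h31 h21
  exact h.graphE_false h11.symm hx₁.symm hx₂ h22 hx₃ (fun h' => hy₁ h'.symm)
    (fun h' => h21 h'.symm) h₁₂ (fun h' => h31 h'.symm) a12 h12 a13 hy₂ a23 (fun h' => h32 h'.symm)

end Structure

/-! ### Balanced separators from the Gyárfás path argument -/

section Separator

variable {V : Type*} (G : SimpleGraph V)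

/-- The set `C` induces a connected subgraph. -/
def IsConn (C : Finset V) : Prop :=
  C.Nonempty ∧ ∀ A ⊆ C, A.Nonempty → A ≠ C → ∃ a ∈ A, ∃ b ∈ C, b ∉ A ∧ G.Adj a b

variable {G}

theorem IsConn.insert_of_adj [DecidableEq V] {C : Finset V} (hC : IsConn G C) {a w : V} (ha : a ∈ C)
    (hw : G.Adj a w) : IsConn G (insert w C) := by
  refine ⟨⟨w, by simp⟩, fun A hA hne hA' => ?_⟩
  by_cases hAC : (A ∩ C).Nonempty
  · by_cases hAC' : A ∩ C = C
    · have hCA : C ⊆ A := by rw [← hAC']; exact Finset.inter_subset_left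
      have : w ∉ A := fun hwA => hA' (hA.antisymm (Finset.insert_subset hwA hCA))
      exact ⟨a, hCA ha, w, by simp, this, hw⟩
    · obtain ⟨x, hx, y, hy, hyA, hxy⟩ := hC.2 _ Finset.inter_subset_right hAC hAC'
      refine ⟨x, (Finset.mem_inter.1 hx).1, y, by simp [hy], fun h => hyA (by simp [h, hy]), hxy⟩
  · obtain ⟨z, hz⟩ := hne
    have hzw : z = w := by
      rcases Finset.mem_insert.1 (hA hz) with h | h
      · exact h
      · exact absurd ⟨z, Finset.mem_inter.2 ⟨hz, h⟩⟩ hAC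
    subst hzw
    exact ⟨z, hz, a, by simp [ha], fun h => hAC ⟨a, by simp [h, ha]⟩, hw.symm⟩

/-- A large connected subset of `T` can be enlarged to one that no vertex of `T` attaches to. -/
theorem IsConn.exists_maximal [DecidableEq V] {T C : Finset V} (hC : IsConn G C) (hCT : C ⊆ T) :
    ∃ Q ⊆ T, IsConn G Q ∧ C.card ≤ Q.card ∧ ∀ w ∈ T, w ∉ Q → ∀ q ∈ Q, ¬ G.Adj q w := by
  classical
  obtain ⟨Q, hQ, hmax⟩ := Finset.exists_max_image
    (T.powerset.filter fun Q => IsConn G Q) Finset.card ⟨C, by simp [hC, hCT]⟩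
  simp only [Finset.mem_filter, Finset.mem_powerset] at hQ hmax
  refine ⟨Q, hQ.1, hQ.2, hmax C ⟨hCT, hC⟩, fun w hw hwQ q hq hadj => ?_⟩
  have := hmax (insert w Q) ⟨Finset.insert_subset hw hQ.1, hQ.2.insert_of_adj hq hadj⟩
  rw [Finset.card_insert_of_notMem hwQ] at this
  omega

/-- A vertex that sees an induced path `p 0, ..., p (t - 1)` and a vertex `q` far from the path
sees one of the two ends. -/
theorem IsBullEFree.adj_end (h : IsBullEFree G) {p : ℕ → V} {t : ℕ} (ht : 4 ≤ t)
    (hp : ∀ i j, i < j → j < t → (G.Adj (p i) (p j) ↔ j = i + 1)) {w q : V} (hwq : G.Adj w q)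
    (hq : ∀ i < t, ¬ G.Adj q (p i)) (hw : ∃ i < t, G.Adj w (p i)) :
    G.Adj w (p 0) ∨ G.Adj w (p (t - 1)) := by
  classical
  by_contra! hcon
  obtain ⟨h0, hl⟩ := hcon
  obtain ⟨i, hi, hmin⟩ := Finset.exists_min_image ((Finset.range t).filter fun i => G.Adj w (p i))
    id (by obtain ⟨i, hi⟩ := hw; exact ⟨i, by simpa using hi⟩)
  obtain ⟨j, hj, hmax⟩ := Finset.exists_max_image ((Finset.range t).filter fun i => G.Adj w (p i))
    id (by obtain ⟨i, hi⟩ := hw; exact ⟨i, by simpa using hi⟩)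
  simp only [Finset.mem_filter, Finset.mem_range, id] at hi hj hmin hmax
  have hi0 : i ≠ 0 := by rintro rfl; exact h0 hi.2
  have hjt : j ≠ t - 1 := by rintro rfl; exact hl hj.2
  have hij := hmin j hj
  have hlow : ∀ m, m < i → ¬ G.Adj w (p m) := fun m hm hadj => by
    have := hmin m ⟨by omega, hadj⟩
    omega
  have hhigh : ∀ m, j < m → m < t → ¬ G.Adj w (p m) := fun m hm hmt hadj => by
    have := hmax m ⟨hmt, hadj⟩
    omega
  have e : ∀ m, m + 1 < t → G.Adj (p m) (p (m + 1)) := fun m hm => (hp m _ (by omega) hm).2 rfl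
  have ne : ∀ m m', m + 1 < m' → m' < t → ¬ G.Adj (p m) (p m') := fun m m' h1 h2 h3 => by
    have := (hp m m' (by omega) h2).1 h3
    omega
  have hs : ∀ {x y : V}, ¬ G.Adj x y → ¬ G.Adj y x := fun h h' => h h'.symm
  obtain ⟨i, rfl⟩ : ∃ i', i = i' + 1 := ⟨i - 1, by omega⟩
  -- The first neighbor of `w` on the path now has index i + 1, the last one index j. A single
  -- neighbor is the center of an E with arms towards `q` and along the path, on whichever side has
  -- two more vertices (4 ≤ t). Two consecutive neighbors form the triangle of a bull with `w`.
  -- Otherwise `w` is the center of an E whose arms leave through the first and the last neighbor,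
  -- with `q` pendant.
  rcases Nat.lt_or_ge j (i + 3) with hj3 | hj3
  · have hji : j = i + 1 ∨ j = i + 2 := by omega
    rcases hji with rfl | rfl
    · by_cases hit : i + 3 < t
      · exact h.graphE_false hwq.symm hi.2 (e (i + 1) (by omega)) (e (i + 2) hit)
          (e i (by omega)).symm (hq _ hi.1) (hq _ (by omega)) (hq _ hit) (hq _ (by omega))
          (hhigh _ (by omega) (by omega)) (hhigh _ (by omega) (by omega)) (hlow _ (by omega))
          (ne _ _ (by omega) (by omega)) (hs (ne _ _ (by omega) (by omega)))
          (hs (ne _ _ (by omega) (by omega)))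
      · obtain ⟨i, rfl⟩ : ∃ i', i = i' + 1 := ⟨i - 1, by omega⟩
        exact h.graphE_false hwq.symm hi.2 (e (i + 1) (by omega)).symm (e i (by omega)).symm
          (e (i + 2) (by omega)) (hq _ hi.1) (hq _ (by omega)) (hq _ (by omega)) (hq _ (by omega))
          (hlow _ (by omega)) (hlow _ (by omega)) (hhigh _ (by omega) (by omega))
          (hs (ne _ _ (by omega) (by omega))) (ne _ _ (by omega) (by omega))
          (ne _ _ (by omega) (by omega))
    · exact h.bull_false (e (i + 1) (by omega)) hj.2.symm hi.2.symm (e i (by omega)).symm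
        (e (i + 2) (by omega)) (ne _ _ (by omega) (by omega)) (hs (ne _ _ (by omega) (by omega)))
        (hlow _ (by omega)) (hhigh _ (by omega) (by omega)) (ne _ _ (by omega) (by omega))
  · exact h.graphE_false (e i (by omega)) hi.2.symm hj.2 (e j (by omega)) hwq
      (hs (hlow _ (by omega))) (ne _ _ (by omega) (by omega)) (ne _ _ (by omega) (by omega))
      (hs (hq _ (by omega))) (ne _ _ (by omega) (by omega)) (ne _ _ (by omega) (by omega))
      (hs (hq _ (by omega))) (hhigh _ (by omega) (by omega)) (hs (hq _ (by omega)))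
      (hs (hq _ (by omega)))

/-- Every connected subset of `S` that avoids the closed neighborhood of `X` has at most half of
the vertices of `S`. -/
def IsBalancedSeparator (G : SimpleGraph V) (S X : Finset V) : Prop :=
  ∀ C ⊆ S, IsConn G C → (∀ x ∈ X, ∀ w ∈ C, w ≠ x ∧ ¬ G.Adj x w) → 2 * C.card ≤ S.card

/-- If `Q` is connected and has more than half of the vertices, `X` dominates the vertices that
attach to `Q`, and `u` splits `Q` well, then `X` and `u` form a balanced separator. -/
theorem isBalancedSeparator_insert [DecidableEq V] {S Q X : Finset V} {u : V} (hQS : Q ⊆ S)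
    (hQ : S.card < 2 * Q.card)
    (hX : ∀ w ∈ S, w ∉ Q → (∃ q ∈ Q, G.Adj q w) → ∃ x ∈ X, G.Adj x w)
    (hu : ∀ C ⊆ Q, IsConn G C → (∀ w ∈ C, w ≠ u ∧ ¬ G.Adj u w) → 2 * C.card ≤ S.card) :
    IsBalancedSeparator G S (insert u X) := by
  intro C hCS hC hdisj
  by_contra! hlt
  by_cases hCQ : C ⊆ Q
  · exact absurd (hu C hCQ hC fun w hw => hdisj u (by simp) w hw) (by omega)
  -- Two subsets of `S` with more than half of its vertices intersect. Hence `C` has an edge leaving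
  -- `Q`, and its outer end is dominated by `X`.
  · have hne : (C ∩ Q).Nonempty := by
      by_contra hemp
      rw [Finset.not_nonempty_iff_eq_empty] at hemp
      have := Finset.card_union_of_disjoint (Finset.disjoint_iff_inter_eq_empty.2 hemp)
      have := Finset.card_le_card (Finset.union_subset hCS hQS)
      omega
    obtain ⟨a, ha, w, hw, hwA, haw⟩ := hC.2 (C ∩ Q) Finset.inter_subset_left hne
      (fun h => hCQ (by rw [← h]; exact Finset.inter_subset_right))
    have hwQ : w ∉ Q := fun h => hwA (by simp [h, hw])
    obtain ⟨x, hx, hxw⟩ := hX w (hCS hw) hwQ ⟨a, (Finset.mem_inter.1 ha).2, haw⟩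
    exact (hdisj x (by simp [hx]) w hw).2 hxw

/-- The growth step of the path argument, by induction on the size of the large side `Q`. -/
theorem IsBullEFree.exists_separator_of_path [DecidableEq V] (h : IsBullEFree G) {S : Finset V} :
    ∀ (m : ℕ) (Q : Finset V) (p : ℕ → V) (t : ℕ) (u : V), Q.card ≤ m → 1 ≤ t →
      (∀ i < t, p i ∈ S) →
      (∀ i j, i < j → j < t → (G.Adj (p i) (p j) ↔ j = i + 1)) →
      Q ⊆ S → IsConn G Q → S.card < 2 * Q.card →
      (∀ q ∈ Q, ∀ i < t, ¬ G.Adj q (p i)) →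
      (∀ w ∈ S, w ∉ Q → (∃ q ∈ Q, G.Adj q w) → ∃ i < t, G.Adj (p i) w) →
      u ∈ S → u ∉ Q → (∀ i < t, (G.Adj (p i) u ↔ i + 1 = t)) → (∃ q ∈ Q, G.Adj q u) →
      ∃ X ⊆ S, X.card ≤ 4 ∧ IsBalancedSeparator G S X := by
  classical
  intro m
  induction m with
  | zero =>
    intro Q p t u hm _ _ _ _ hQ
    exact absurd hQ.1 (by simpa using hm)
  | succ m ih =>
    intro Q p t u hm ht hpS hp hQS hQ hbig hanti hnb huS huQ hu huq
    by_cases hsplit : ∀ C ⊆ Q, IsConn G C → (∀ w ∈ C, w ≠ u ∧ ¬ G.Adj u w) → 2 * C.card ≤ S.card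
    -- A path of at most three vertices is taken as a whole, which with `u` gives the bound four. On
    -- a longer path the two ends suffice by `IsBullEFree.adj_end`.
    · by_cases ht4 : t < 4
      · refine ⟨insert u ((Finset.range t).image p), ?_, ?_, ?_⟩
        · apply Finset.insert_subset huS
          intro x hx
          obtain ⟨i, hi, rfl⟩ := Finset.mem_image.1 hx
          exact hpS i (by simpa using hi)
        · have h1 := Finset.card_insert_le u ((Finset.range t).image p)
          have h2 := Finset.card_image_le (s := Finset.range t) (f := p)
          rw [Finset.card_range] at h2
          omega
        · refine isBalancedSeparator_insert hQS hbig (fun w hw hwQ hq => ?_) hsplit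
          obtain ⟨i, hi, hadj⟩ := hnb w hw hwQ hq
          exact ⟨p i, Finset.mem_image.2 ⟨i, by simpa using hi, rfl⟩, hadj⟩
      · refine ⟨insert u {p 0, p (t - 1)}, ?_, ?_, ?_⟩
        · apply Finset.insert_subset huS
          intro x hx
          simp only [Finset.mem_insert, Finset.mem_singleton] at hx
          rcases hx with rfl | rfl
          · exact hpS _ (by omega)
          · exact hpS _ (by omega)
        · exact Finset.card_le_three.trans (by norm_num)
        · refine isBalancedSeparator_insert hQS hbig (fun w hw hwQ hq => ?_) hsplit
          obtain ⟨i, hi, hadj⟩ := hnb w hw hwQ hq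
          obtain ⟨q, hqQ, hqw⟩ := hq
          rcases h.adj_end (by omega) hp hqw.symm (hanti q hqQ) ⟨i, hi, hadj.symm⟩ with h1 | h1
          · exact ⟨p 0, by simp, h1.symm⟩
          · exact ⟨p (t - 1), by simp, h1.symm⟩
    · push Not at hsplit
      obtain ⟨C, hCQ, hC, hCu, hCbig⟩ := hsplit
      obtain ⟨Q', hQ'T, hQ', hcard, hmax⟩ := hC.exists_maximal
        (T := Q.filter fun w => w ≠ u ∧ ¬ G.Adj u w)
        (fun w hw => Finset.mem_filter.2 ⟨hCQ hw, hCu w hw⟩)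
      have hQ'Q : Q' ⊆ Q := hQ'T.trans (Finset.filter_subset _ _)
      have hQ'u : ∀ q ∈ Q', ¬ G.Adj u q := fun q hq => (Finset.mem_filter.1 (hQ'T hq)).2.2
      obtain ⟨q₀, hq₀, hq₀u⟩ := huq
      have hne : Q' ≠ Q := fun he => hQ'u q₀ (he ▸ hq₀) hq₀u.symm
      obtain ⟨a, ha, u', hu', hu'Q, hau'⟩ := hQ.2 Q' hQ'Q hQ'.1 hne
      -- `Q'` is a component of `Q` outside the closed neighborhood of `u`, so whatever attaches to
      -- it inside `Q` is a neighbor of `u`. This makes `u` the next vertex of the path and `u'` a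
      -- vertex that sees only this new end.
      have hadj : ∀ w ∈ Q, w ∉ Q' → (∃ q ∈ Q', G.Adj q w) → G.Adj u w := by
        rintro w hw hwQ' ⟨q, hq, hqw⟩
        by_contra hcon
        exact hmax w (Finset.mem_filter.2 ⟨hw, by rintro rfl; exact huQ hw, hcon⟩) hwQ' q hq hqw
      have hupd : ∀ i < t, Function.update p t u i = p i := fun i hi =>
        Function.update_of_ne (by omega) _ _
      have hpt : Function.update p t u t = u := Function.update_self _ _ _
      refine ih Q' (Function.update p t u) (t + 1) u' ?_ (by omega) ?_ ?_ (hQ'Q.trans hQS) hQ'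
        (by omega) ?_ ?_ (hQS hu') hu'Q ?_ ⟨a, ha, hau'⟩
      · have := Finset.card_lt_card (hQ'Q.ssubset_of_ne hne)
        omega
      · intro i hi
        rcases Nat.lt_succ_iff_lt_or_eq.1 hi with hi | rfl
        · rw [hupd i hi]; exact hpS i hi
        · rw [hpt]; exact huS
      · intro i j hij hj
        rcases Nat.lt_succ_iff_lt_or_eq.1 hj with hj | rfl
        · rw [hupd i (by omega), hupd j hj]; exact hp i j hij hj
        · rw [hupd i hij, hpt, hu i hij]; omega
      · intro q hq i hi
        rcases Nat.lt_succ_iff_lt_or_eq.1 hi with hi | rfl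
        · rw [hupd i hi]; exact hanti q (hQ'Q hq) i hi
        · rw [hpt]; exact fun h' => hQ'u q hq h'.symm
      · rintro w hw hwQ' ⟨q, hq, hqw⟩
        by_cases hwQ : w ∈ Q
        · exact ⟨t, by omega, by rw [hpt]; exact hadj w hwQ hwQ' ⟨q, hq, hqw⟩⟩
        · obtain ⟨i, hi, hiw⟩ := hnb w hw hwQ ⟨q, hQ'Q hq, hqw⟩
          exact ⟨i, by omega, by rw [hupd i hi]; exact hiw⟩
      · intro i hi
        rcases Nat.lt_succ_iff_lt_or_eq.1 hi with hi | rfl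
        · rw [hupd i hi]
          exact ⟨fun h' => absurd h'.symm (hanti u' hu' i hi), fun h' => by omega⟩
        · rw [hpt]
          exact ⟨fun _ => rfl, fun _ => hadj u' hu' hu'Q ⟨a, ha, hau'⟩⟩

/-- Every set of vertices of a (bull, E)-free graph has a balanced separator that is contained in
the closed neighborhood of at most four of its vertices. -/
theorem IsBullEFree.exists_separator (h : IsBullEFree G) (S : Finset V) :
    ∃ X ⊆ S, X.card ≤ 4 ∧ IsBalancedSeparator G S X := by
  classical
  by_cases hS : ∀ C ⊆ S, IsConn G C → 2 * C.card ≤ S.card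
  · exact ⟨∅, by simp, by simp, fun C hC hconn _ => hS C hC hconn⟩
  push Not at hS
  obtain ⟨C, hCS, hC, hCbig⟩ := hS
  obtain ⟨Q₀, hQ₀S, hQ₀, hcard₀, hmax₀⟩ := hC.exists_maximal hCS
  obtain ⟨u, hu⟩ := hQ₀.1
  by_cases hsplit : ∀ C ⊆ Q₀, IsConn G C → (∀ w ∈ C, w ≠ u ∧ ¬ G.Adj u w) → 2 * C.card ≤ S.card
  · refine ⟨insert u ∅, by simpa using hQ₀S hu, by simp, ?_⟩
    refine isBalancedSeparator_insert hQ₀S (by omega) ?_ hsplit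
    rintro w hw hwQ ⟨q, hq, hqw⟩
    exact absurd hqw (hmax₀ w hw hwQ q hq)
  push Not at hsplit
  obtain ⟨C', hC'Q, hC', hC'u, hC'big⟩ := hsplit
  obtain ⟨Q, hQT, hQ, hcard, hmax⟩ := hC'.exists_maximal
    (T := Q₀.filter fun w => w ≠ u ∧ ¬ G.Adj u w)
    (fun w hw => Finset.mem_filter.2 ⟨hC'Q hw, hC'u w hw⟩)
  have hQQ₀ : Q ⊆ Q₀ := hQT.trans (Finset.filter_subset _ _)
  have huQ : u ∉ Q := fun hq => (Finset.mem_filter.1 (hQT hq)).2.1 rfl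
  obtain ⟨a, ha, u', hu', hu'Q, hau'⟩ := hQ₀.2 Q hQQ₀ hQ.1 (fun he => huQ (he ▸ hu))
  have hnb : ∀ w ∈ S, w ∉ Q → (∃ q ∈ Q, G.Adj q w) → G.Adj u w := by
    rintro w hw hwQ ⟨q, hq, hqw⟩
    have hwQ₀ : w ∈ Q₀ := by
      by_contra hcon
      exact hmax₀ w hw hcon q (hQQ₀ hq) hqw
    by_contra hcon
    by_cases hwu : w = u
    · subst hwu
      exact (Finset.mem_filter.1 (hQT hq)).2.2 hqw.symm
    · exact hmax w (Finset.mem_filter.2 ⟨hwQ₀, hwu, hcon⟩) hwQ q hq hqw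
  -- The induction starts with the path consisting of `u` alone.
  refine h.exists_separator_of_path Q.card Q (fun _ => u) 1 u' le_rfl le_rfl (fun _ _ => hQ₀S hu)
    (fun i j hij hj => by omega) (hQQ₀.trans hQ₀S) hQ (by omega) ?_ ?_ (hQ₀S hu') hu'Q ?_
    ⟨a, ha, hau'⟩
  · intro q hq i _ hadj
    exact (Finset.mem_filter.1 (hQT hq)).2.2 hadj.symm
  · intro w hw hwQ hex
    exact ⟨0, by omega, hnb w hw hwQ hex⟩
  · intro i hi
    exact ⟨fun _ => by omega, fun _ => hnb u' (hQ₀S hu') hu'Q ⟨a, ha, hau'⟩⟩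

end Separator

end ListColoring

namespace ListColoring

/-! ### Refutations with few assignments -/

section Refutation

set_option linter.unusedSectionVars false

variable {V α : Type*} [DecidableEq V] [DecidableEq α] (G : SimpleGraph V)

open Classical in
/-- Give the color `c` to the vertex `v`: the neighbors of `v` lose `c`. -/
noncomputable def assign (L : V → Finset α) (v : V) (c : α) : V → Finset α := fun u =>
  if u = v then L u ∩ {c} else if G.Adj v u then (L u).erase c else L u

/-- Forbid the color `c` at the vertex `v`. -/
def remove (L : V → Finset α) (v : V) (c : α) : V → Finset α := fun u =>
  if u = v then (L u).erase c else L u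

/-- `Refutable G r L`: a search tree shows that there is no coloring from the lists `L`, where
on each branch at most `r` vertices are given a color; forbidding colors is free. -/
inductive Refutable : ℕ → (V → Finset α) → Prop
  | empty {r : ℕ} {L : V → Finset α} (v : V) : L v = ∅ → Refutable r L
  | branch {r : ℕ} {L : V → Finset α} (v : V) (c : α) :
      Refutable r (assign G L v c) → Refutable (r + 1) (remove L v c) → Refutable (r + 1) L

/-- There is a coloring of the subgraph induced by `S` from the lists `L`. -/
def ColorableOn (L : V → Finset α) (S : Finset V) : Prop :=
  ∃ f : V → α, (∀ u ∈ S, f u ∈ L u) ∧ ∀ u ∈ S, ∀ w ∈ S, G.Adj u w → f u ≠ f w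

variable {G}

theorem mem_assign {L : V → Finset α} {v u : V} {c d : α} :
    d ∈ assign G L v c u ↔ d ∈ L u ∧ (u = v → d = c) ∧ (G.Adj v u → d ≠ c) := by
  unfold assign
  split_ifs with h1 h2
  · subst h1; simp
  · simp [h1, h2, and_comm]
  · simp [h1, h2]

theorem mem_remove {L : V → Finset α} {v u : V} {c d : α} :
    d ∈ remove L v c u ↔ d ∈ L u ∧ (u = v → d ≠ c) := by
  unfold remove
  split_ifs with h1
  · simp [h1, and_comm]
  · simp [h1]

theorem assign_subset (L : V → Finset α) (v : V) (c : α) (u : V) : assign G L v c u ⊆ L u :=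
  fun _ hd => (mem_assign.1 hd).1

theorem remove_subset (L : V → Finset α) (v : V) (c : α) (u : V) : remove L v c u ⊆ L u :=
  fun _ hd => (mem_remove.1 hd).1

theorem Refutable.mono {r r' : ℕ} {L L' : V → Finset α} (h : Refutable G r L) (hr : r ≤ r')
    (hL : ∀ v, L' v ⊆ L v) : Refutable G r' L' := by
  induction h generalizing r' L' with
  | empty v hv => exact .empty v (Finset.subset_empty.1 (hv ▸ hL v))
  | @branch r L v c _ _ ih1 ih2 =>
    obtain ⟨r', rfl⟩ : ∃ s, r' = s + 1 := ⟨r' - 1, by omega⟩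
    refine .branch v c (ih1 (by omega) fun u d hd => ?_) (ih2 hr fun u d hd => ?_)
    · rw [mem_assign] at hd ⊢
      exact ⟨hL u hd.1, hd.2⟩
    · rw [mem_remove] at hd ⊢
      exact ⟨hL u hd.1, hd.2⟩

/-- At the cost of one assignment, either `c` disappears from `Y`, or it is given to a vertex
of `Y` that maximizes `g` among the vertices of `Y` that may still have it. -/
theorem Refutable.of_query (Y : Finset V) (g : V → ℕ) (c : α) (r : ℕ) (L : V → Finset α)
    (hyes : ∀ L' : V → Finset α, (∀ v, L' v ⊆ L v) → ∀ y ∈ Y, c ∈ L' y →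
      (∀ y' ∈ Y, c ∈ L' y' → g y' ≤ g y) → Refutable G r (assign G L' y c))
    (hno : ∀ L' : V → Finset α, (∀ v, L' v ⊆ L v) → (∀ y ∈ Y, c ∉ L' y) →
      Refutable G (r + 1) L') : Refutable G (r + 1) L := by
  induction hm : (Y.filter fun y => c ∈ L y).card using Nat.strong_induction_on generalizing L with
  | _ m ih =>
    by_cases hne : (Y.filter fun y => c ∈ L y).Nonempty
    · obtain ⟨y, hy, hmax⟩ := Finset.exists_max_image _ g hne
      simp only [Finset.mem_filter] at hy hmax
      refine .branch y c (hyes L (fun _ => subset_rfl) y hy.1 hy.2 fun y' h1 h2 =>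
        hmax y' ⟨h1, h2⟩) (ih _ ?_ _ (fun L' hL' => hyes L' fun v =>
          (hL' v).trans (remove_subset _ _ _ _)) (fun L' hL' => hno L' fun v =>
          (hL' v).trans (remove_subset _ _ _ _)) rfl)
      rw [← hm]
      apply Finset.card_lt_card
      refine (Finset.ssubset_iff_of_subset fun u hu => ?_).2 ⟨y, by simp [hy], by simp [mem_remove]⟩
      simp only [Finset.mem_filter, mem_remove] at hu ⊢
      exact ⟨hu.1, hu.2.1⟩
    · rw [Finset.not_nonempty_iff_eq_empty, Finset.filter_eq_empty_iff] at hne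
      exact hno L (fun _ => subset_rfl) hne

/-- No conflict in the color `c` joins a neighbor of `v` to a vertex outside the closed
neighborhood of `v`. -/
def Separated (G : SimpleGraph V) (S : Finset V) (L : V → Finset α) (v : V) (c : α) : Prop :=
  ∀ x ∈ S, ∀ y ∈ S, G.Adj v x → ¬ G.Adj v y → y ≠ v → G.Adj x y → c ∈ L x → c ∉ L y

/-- The vertex `v` has at most one color, which none of its neighbors may use. -/
def Fixed (G : SimpleGraph V) (D : Finset α) (L : V → Finset α) (v : V) : Prop :=
  ∃ c ∈ D, L v ⊆ {c} ∧ ∀ w, G.Adj v w → c ∉ L w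

theorem Separated.mono {S : Finset V} {L L' : V → Finset α} {v : V} {c : α}
    (h : Separated G S L v c) (hL : ∀ v, L' v ⊆ L v) : Separated G S L' v c :=
  fun x hx y hy h1 h2 h3 h4 h5 h6 => h x hx y hy h1 h2 h3 h4 (hL x h5) (hL y h6)

theorem Fixed.mono {D : Finset α} {L L' : V → Finset α} {v : V} (h : Fixed G D L v)
    (hL : ∀ v, L' v ⊆ L v) : Fixed G D L' v := by
  obtain ⟨c, hc, h1, h2⟩ := h
  exact ⟨c, hc, (hL v).trans h1, fun w hw hcw => h2 w hw (hL w hcw)⟩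

theorem Finset.exists_mem_notMem_of_card_le {A B : Finset V} (h : A.card ≤ B.card) {x : V}
    (hxA : x ∈ A) (hxB : x ∉ B) : ∃ y ∈ B, y ∉ A := by
  by_contra! hcon
  exact absurd (Finset.card_lt_card ((Finset.ssubset_iff_of_subset hcon).2 ⟨x, hxA, hxB⟩))
    (by omega)

/-- Two assignments suffice to remove the conflicts in one color between the neighbors and the
nonneighbors of a vertex. -/
theorem IsBullEFree.refutable_of_separated (h : IsBullEFree G) (S : Finset V) (v : V) (c : α)
    (r : ℕ) (L : V → Finset α)
    (hL : ∀ L' : V → Finset α, (∀ v, L' v ⊆ L v) → Separated G S L' v c → Refutable G r L') :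
    Refutable G (r + 2) L := by
  classical
  -- `X` refers to the lists before the queries, so both queries maximize a count over the same
  -- fixed set: first the neighbors in `X`, then the neighbors in `X` that `y₁` does not see.
  let X := S.filter fun x => G.Adj v x ∧ c ∈ L x
  let Y := S.filter fun y => ¬ G.Adj v y ∧ y ≠ v
  have hgone : ∀ L' : V → Finset α, (∀ y ∈ Y, c ∉ L' y) → Separated G S L' v c :=
    fun L' hL' x _ y hy _ h2 h3 _ _ => hL' y (by simp [Y, hy, h2, h3])
  refine .of_query Y (fun y => (X.filter fun x => G.Adj x y).card) c (r + 1) L ?_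
    fun L' h1 h2 => (hL L' h1 (hgone L' h2)).mono (by omega) fun _ => subset_rfl
  intro L₁ hL₁ y₁ hy₁ _ hmax₁
  have hL₁' := fun u => (assign_subset (G := G) L₁ y₁ c u)
  refine .of_query Y (fun y => (X.filter fun x => G.Adj x y ∧ ¬ G.Adj x y₁).card) c r _ ?_
    fun L' h1 h2 => (hL L' (fun u => (h1 u).trans ((hL₁' u).trans (hL₁ u))) (hgone L' h2)).mono
      (by omega) fun _ => subset_rfl
  intro L₂ hL₂ y₂ hy₂ hcy₂ hmax₂
  have hL₂' : ∀ u, L₂ u ⊆ L₁ u := fun u => (hL₂ u).trans (hL₁' u)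
  refine hL _ (fun u => (assign_subset _ _ _ _).trans ((hL₂' u).trans (hL₁ u))) ?_
  -- A conflict that survives both assignments has its ends away from the vertices that took `c`, as
  -- far as these would have removed `c`. Maximality of `y₂` against `y₃` yields a private neighbor
  -- `x₂`, and maximality of `y₁` against `y₂` yields `x₁`; together they form the excluded
  -- configuration.
  intro x₃ hx₃ y₃ hy₃ hvx₃ hvy₃ hy₃v hxy₃ hcx₃ hcy₃
  rw [mem_assign] at hcx₃ hcy₃
  have h32 : ¬ G.Adj x₃ y₂ := fun ha => hcx₃.2.2 ha.symm rfl
  have h31 : ¬ G.Adj x₃ y₁ := fun ha => (mem_assign.1 (hL₂ _ hcx₃.1)).2.2 ha.symm rfl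
  have h23 : ¬ G.Adj y₂ y₃ := fun ha => hcy₃.2.2 ha rfl
  have h12 : ¬ G.Adj y₁ y₂ := fun ha => (mem_assign.1 (hL₂ _ hcy₂)).2.2 ha rfl
  have hx₃X : x₃ ∈ X := by simp [X, hx₃, hvx₃, hL₁ _ (hL₂' _ hcx₃.1)]
  have hy₃Y : y₃ ∈ Y := by simp [Y, hy₃, hvy₃, hy₃v]
  obtain ⟨x₂, hx₂, hx₂'⟩ := Finset.exists_mem_notMem_of_card_le (hmax₂ y₃ hy₃Y hcy₃.1)
    (x := x₃) (by simp [hx₃X, hxy₃, h31]) (by simp [h32])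
  simp only [Finset.mem_filter, not_and, not_not] at hx₂ hx₂'
  have h23' : ¬ G.Adj x₂ y₃ := fun ha => hx₂.2.2 (hx₂' hx₂.1 ha)
  obtain ⟨x₁, hx₁, hx₁'⟩ := Finset.exists_mem_notMem_of_card_le (hmax₁ y₂ hy₂ (hL₂' _ hcy₂))
    (x := x₂) (by simp [hx₂.1, hx₂.2.1]) (by simp [hx₂.2.2])
  simp only [Finset.mem_filter, not_and] at hx₁ hx₁'
  simp only [X, Y, Finset.mem_filter] at hx₁ hx₂ hy₁ hy₂
  exact h.no_third_private hx₁.1.2.1 hx₂.1.2.1 hvx₃ hy₁.2.1 hy₂.2.1 hvy₃ h12 h23 hx₁.2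
    (hx₁' (by simp [X, hx₁.1])) hx₂.2.1 hx₂.2.2 h23' hxy₃ h31 h32

theorem IsBullEFree.refutable_of_forall_separated (h : IsBullEFree G) (S : Finset V) (v : V)
    (D : Finset α) (r : ℕ) (L : V → Finset α)
    (hL : ∀ L' : V → Finset α, (∀ v, L' v ⊆ L v) → (∀ c ∈ D, Separated G S L' v c) →
      Refutable G r L') : Refutable G (r + 2 * D.card) L := by
  induction D using Finset.induction_on generalizing L with
  | empty => exact hL L (fun _ => subset_rfl) (by simp)
  | insert c D hc ih =>
    rw [Finset.card_insert_of_notMem hc, show r + 2 * (D.card + 1) = r + 2 * D.card + 2 by ring]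
    refine h.refutable_of_separated S v c _ L fun L₁ hL₁ hsep => ih L₁ fun L₂ hL₂ hsep₂ => ?_
    refine hL L₂ (fun u => (hL₂ u).trans (hL₁ u)) fun d hd => ?_
    rcases Finset.mem_insert.1 hd with rfl | hd
    · exact hsep.mono hL₂
    · exact hsep₂ d hd

/-- The colors of `v` are tried one after the other. A failed color is forbidden at no cost, and
when all have failed the list is empty, so every branch pays for one assignment only. -/
theorem Refutable.of_fixed (v : V) (D : Finset α) (r : ℕ) (L : V → Finset α) (hD : L v ⊆ D)
    (hL : ∀ L' : V → Finset α, (∀ v, L' v ⊆ L v) → Fixed G D L' v → Refutable G r L') :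
    Refutable G (r + 1) L := by
  induction hm : (L v).card using Nat.strong_induction_on generalizing L with
  | _ m ih =>
    by_cases hne : (L v).Nonempty
    · obtain ⟨c, hc⟩ := hne
      refine .branch v c (hL _ (assign_subset _ _ _) ⟨c, hD hc, ?_, ?_⟩)
        (ih _ ?_ _ ((remove_subset _ _ _ _).trans hD)
          (fun L' hL' => hL L' fun v => (hL' v).trans (remove_subset _ _ _ _)) rfl)
      · intro d hd
        simpa using (mem_assign.1 hd).2.1 rfl
      · intro w hw hcw
        exact (mem_assign.1 hcw).2.2 hw rfl
      · rw [← hm]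
        apply Finset.card_lt_card
        exact (Finset.ssubset_iff_of_subset (remove_subset _ _ _ _)).2 ⟨c, hc, by simp [mem_remove]⟩
    · exact .empty v (Finset.not_nonempty_iff_eq_empty.1 hne)

/-- Each vertex of `X` costs one assignment for its own color and two per color for the separation.
Later restrictions of the lists preserve both properties, so the vertices can be treated in turn. -/
theorem IsBullEFree.refutable_of_fixed_separated (h : IsBullEFree G) (S X : Finset V)
    (D : Finset α) (r : ℕ) (L : V → Finset α) (hD : ∀ x ∈ X, L x ⊆ D)
    (hL : ∀ L' : V → Finset α, (∀ v, L' v ⊆ L v) → (∀ x ∈ X, Fixed G D L' x) →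
      (∀ x ∈ X, ∀ c ∈ D, Separated G S L' x c) → Refutable G r L') :
    Refutable G (r + X.card * (2 * D.card + 1)) L := by
  induction X using Finset.induction_on generalizing L with
  | empty => simpa using hL L (fun _ => subset_rfl) (by simp) (by simp)
  | insert x X hx ih =>
    rw [Finset.card_insert_of_notMem hx, show r + (X.card + 1) * (2 * D.card + 1) =
      r + X.card * (2 * D.card + 1) + 2 * D.card + 1 by ring]
    refine .of_fixed x D _ L (hD x (by simp)) fun L₁ hL₁ hfix => ?_
    refine h.refutable_of_forall_separated S x D _ L₁ fun L₂ hL₂ hsep => ?_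
    refine ih L₂ (fun y hy => (hL₂ y).trans ((hL₁ y).trans (hD y (by simp [hy]))))
      fun L₃ hL₃ hfix₃ hsep₃ => ?_
    refine hL L₃ (fun u => (hL₃ u).trans ((hL₂ u).trans (hL₁ u))) ?_ ?_
    · intro y hy
      rcases Finset.mem_insert.1 hy with rfl | hy
      · exact hfix.mono fun u => (hL₃ u).trans (hL₂ u)
      · exact hfix₃ y hy
    · intro y hy c hc
      rcases Finset.mem_insert.1 hy with rfl | hy
      · exact (hsep c hc).mono hL₃
      · exact hsep₃ y hy c hc

theorem ColorableOn.mono {L L' : V → Finset α} {S S' : Finset V} (h : ColorableOn G L' S)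
    (hL : ∀ v ∈ S', L' v ⊆ L v) (hS : S' ⊆ S) : ColorableOn G L S' := by
  obtain ⟨f, hf, hf'⟩ := h
  exact ⟨f, fun u hu => hL u hu (hf u (hS hu)), fun u hu w hw => hf' u (hS hu) w (hS hw)⟩

theorem colorableOn_empty [Nonempty α] (L : V → Finset α) : ColorableOn G L ∅ :=
  ⟨fun _ => Classical.arbitrary α, by simp, by simp⟩

theorem colorableOn_of_subset_singleton [Nonempty α] {L : V → Finset α} {S : Finset V} {v : V}
    (hS : S ⊆ {v}) (hv : (L v).Nonempty) : ColorableOn G L S := by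
  obtain ⟨c, hc⟩ := hv
  refine ⟨fun _ => c, fun u hu => ?_, fun u hu w hw ha => ?_⟩
  · rw [Finset.mem_singleton.1 (hS hu)]; exact hc
  · rw [Finset.mem_singleton.1 (hS hu), Finset.mem_singleton.1 (hS hw)] at ha
    exact absurd ha G.irrefl

/-- Colorings of two parts without conflicts between them can be combined. -/
theorem ColorableOn.of_parts {L : V → Finset α} {S : Finset V} (p : V → Prop) [DecidablePred p]
    (hA : ColorableOn G L (S.filter p)) (hB : ColorableOn G L (S.filter fun v => ¬ p v))
    (hAB : ∀ a ∈ S, ∀ b ∈ S, p a → ¬ p b → G.Adj a b → ∀ c ∈ L a, c ∉ L b) :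
    ColorableOn G L S := by
  obtain ⟨f, hf, hf'⟩ := hA
  obtain ⟨g, hg, hg'⟩ := hB
  simp only [Finset.mem_filter] at hf hf' hg hg'
  refine ⟨fun v => if p v then f v else g v, fun u hu => ?_, fun u hu w hw ha => ?_⟩
  · by_cases hp : p u
    · simpa [hp] using hf u ⟨hu, hp⟩
    · simpa [hp] using hg u ⟨hu, hp⟩
  · by_cases hp : p u <;> by_cases hq : p w <;> simp only [hp, hq, if_true, if_false]
    · exact hf' u ⟨hu, hp⟩ w ⟨hw, hq⟩ ha
    · exact fun he => hAB u hu w hw hp hq ha _ (hf u ⟨hu, hp⟩) (he ▸ hg w ⟨hw, hq⟩)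
    · exact fun he => hAB w hw u hu hq hp ha.symm _ (hf w ⟨hw, hq⟩) (he ▸ hg u ⟨hu, hp⟩)
    · exact hg' u ⟨hu, hp⟩ w ⟨hw, hq⟩ ha

/-- Across a cut without edges, colorings of the two sides combine, so one of the sides is
uncolorable and smaller. -/
theorem exists_isConn_not_colorableOn [Nonempty α] {L : V → Finset α} (T : Finset V)
    (hT : ¬ ColorableOn G L T) : ∃ C ⊆ T, IsConn G C ∧ ¬ ColorableOn G L C := by
  induction T using Finset.strongInduction with
  | _ T ih =>
    by_cases hconn : IsConn G T
    · exact ⟨T, subset_rfl, hconn, hT⟩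
    · have hne : T.Nonempty := by
        rw [Finset.nonempty_iff_ne_empty]
        rintro rfl
        exact hT (colorableOn_empty L)
      simp only [IsConn, hne, true_and] at hconn
      push Not at hconn
      obtain ⟨A, hAT, hA, hAne, hadj⟩ := hconn
      have h1 : T.filter (· ∈ A) = A := by ext x; simpa using @hAT x
      by_cases hcol : ColorableOn G L A
      · have hB : ¬ ColorableOn G L (T.filter fun v => ¬ v ∈ A) := fun hB =>
          hT (.of_parts (· ∈ A) (by rwa [h1]) hB fun a _ b hb ha hb' hab =>
            absurd hab (hadj a ha b hb hb'))
        obtain ⟨a, ha⟩ := hA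
        obtain ⟨C, hC, h2⟩ := ih _ ((Finset.ssubset_iff_of_subset (Finset.filter_subset _ _)).2
          ⟨a, hAT ha, by simp [ha]⟩) hB
        exact ⟨C, hC.trans (Finset.filter_subset _ _), h2⟩
      · obtain ⟨C, hC, h2⟩ := ih _ (hAT.ssubset_of_ne hAne) hcol
        exact ⟨C, hC.trans hAT, h2⟩

/-- One assignment per vertex. This crude depth serves the instances with fewer vertices than
colors. -/
theorem refutable_card_of_not_colorableOn [Nonempty α] (m : ℕ) (S : Finset V) (hm : S.card = m)
    (L : V → Finset α) (hS : ¬ ColorableOn G L S) : Refutable G m L := by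
  induction m generalizing S L with
  | zero =>
    rw [Finset.card_eq_zero] at hm
    subst hm
    exact absurd (colorableOn_empty L) hS
  | succ m ih =>
    obtain ⟨x, hx⟩ : S.Nonempty := by rw [← Finset.card_pos]; omega
    refine .of_fixed x (L x) _ L subset_rfl fun L' hL' hfix => ?_
    by_cases hxe : (L' x).Nonempty
    · refine ih (S.erase x) (by rw [Finset.card_erase_of_mem hx]; omega) L' fun hcol => hS ?_
      refine ColorableOn.mono (L' := L') (S := S) ?_ (fun v _ => hL' v) subset_rfl
      refine .of_parts (· = x)
        (colorableOn_of_subset_singleton (fun y hy => by simp_all) hxe) ?_ ?_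
      · exact hcol.mono (fun _ _ => subset_rfl) fun y hy => by simp_all
      · rintro a _ b _ rfl _ hab c hc
        obtain ⟨d, _, h1, h2⟩ := hfix
        rw [Finset.mem_singleton.1 (h1 hc)]
        exact h2 b hab
    · exact .empty x (Finset.not_nonempty_iff_eq_empty.1 hxe)

/-- An uncolorable set of at most `2 ^ a` vertices with `d` colors is refuted with
`12 * d * (a + d)` assignments on each branch. -/
theorem IsBullEFree.refutable_of_not_colorableOn [Nonempty α] (h : IsBullEFree G) (N : ℕ) :
    ∀ (a : ℕ) (S : Finset V) (D : Finset α) (L : V → Finset α), a + D.card ≤ N →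
      S.card ≤ 2 ^ a → (∀ v ∈ S, L v ⊆ D) → ¬ ColorableOn G L S →
      Refutable G (12 * D.card * (a + D.card)) L := by
  classical
  induction N with
  | zero =>
    intro a S D L hN _ hLD hS
    have hD : D = ∅ := Finset.card_eq_zero.1 (by omega)
    obtain ⟨v, hv⟩ : S.Nonempty := by
      rw [Finset.nonempty_iff_ne_empty]; rintro rfl; exact hS (colorableOn_empty L)
    exact .empty v (Finset.subset_empty.1 (hD ▸ hLD v hv))
  | succ N ih =>
    intro a S D L hN hcard hLD hS
    obtain ⟨v, hv⟩ : S.Nonempty := by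
      rw [Finset.nonempty_iff_ne_empty]; rintro rfl; exact hS (colorableOn_empty L)
    by_cases hD : D.card = 0
    · rw [Finset.card_eq_zero] at hD
      exact .empty v (Finset.subset_empty.1 (hD ▸ hLD v hv))
    by_cases ha : a = 0
    · subst ha
      have hSv : S ⊆ {v} := fun w hw => by
        have := Finset.card_le_one.1 (by simpa using hcard) w hw v hv
        simpa using this
      by_cases hne : (L v).Nonempty
      · exact absurd (colorableOn_of_subset_singleton hSv hne) hS
      · exact .empty v (Finset.not_nonempty_iff_eq_empty.1 hne)
    obtain ⟨d, hd⟩ : ∃ d, D.card = d + 1 := ⟨D.card - 1, by omega⟩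
    obtain ⟨a, rfl⟩ : ∃ a', a = a' + 1 := ⟨a - 1, by omega⟩
    obtain ⟨X, hXS, hX4, hX⟩ := h.exists_separator S
    have key : Refutable G (12 * (d + 1) * (a + (d + 1)) + X.card * (2 * D.card + 1)) L := by
      refine h.refutable_of_fixed_separated S X D _ L (fun x hx => hLD x (hXS hx))
        fun L' hL' hfix hsep => ?_
      have hL'D : ∀ v ∈ S, L' v ⊆ D := fun v hv => (hL' v).trans (hLD v hv)
      by_contra hcon
      -- Deleting the closed neighborhoods of separator vertices one by one keeps the rest
      -- uncolorable. The color of `x` is gone from its neighbors, the neighbors have no conflict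
      -- with the vertices beyond them, and the neighborhood itself is colorable, since otherwise
      -- the induction hypothesis with one color fewer would refute it.
      have peel : ∀ X' ⊆ X, ¬ ColorableOn G L' (S.filter fun w => ∀ x ∈ X', w ≠ x ∧ ¬ G.Adj x w) := by
        intro X'
        induction X' using Finset.induction_on with
        | empty =>
          intro _ hcol
          exact hS (hcol.mono (fun v _ => hL' v) (by simp))
        | insert x X' hx ihX =>
          intro hXX hcol
          have hxX : x ∈ X := hXX (by simp)
          have hX'X : X' ⊆ X := (Finset.subset_insert _ _).trans hXX
          obtain ⟨c, hcD, hc1, hc2⟩ := hfix x hxX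
          have hxne : (L' x).Nonempty := by
            by_contra hne
            exact hcon (.empty x (Finset.not_nonempty_iff_eq_empty.1 hne))
          have hnbr : ColorableOn G L' (S.filter fun w => G.Adj x w) := by
            by_contra hncol
            have hlt : (D.erase c).card = d := by rw [Finset.card_erase_of_mem hcD]; omega
            have := ih (a + 1) _ (D.erase c) L' (by omega)
              ((Finset.card_le_card (Finset.filter_subset _ _)).trans hcard) (fun w hw => by
                rw [Finset.mem_filter] at hw
                exact Finset.subset_erase.2 ⟨hL'D w hw.1, hc2 w hw.2⟩) hncol
            refine hcon (this.mono ?_ fun _ => subset_rfl)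
            rw [hlt]
            nlinarith
          refine ihX hX'X (.of_parts (· = x)
            (colorableOn_of_subset_singleton (fun y hy => by simp_all) hxne) ?_ ?_)
          · refine .of_parts (fun w => G.Adj x w) ?_ ?_ ?_
            · refine hnbr.mono (fun _ _ => subset_rfl) fun w hw => ?_
              simp only [Finset.mem_filter] at hw ⊢
              exact ⟨hw.1.1.1, hw.2⟩
            · refine hcol.mono (fun _ _ => subset_rfl) fun w hw => ?_
              simp only [Finset.mem_filter, Finset.mem_insert, forall_eq_or_imp] at hw ⊢
              exact ⟨hw.1.1.1, ⟨hw.1.2, hw.2⟩, hw.1.1.2⟩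
            · intro y hy z hz hxy hxz hyz e he
              simp only [Finset.mem_filter] at hy hz
              exact hsep x hxX e (hL'D y hy.1.1 he) y hy.1.1 z hz.1.1 hxy hxz hz.2 hyz he
          · rintro y _ z _ rfl _ hyz e he
            rw [Finset.mem_singleton.1 (hc1 he)]
            exact hc2 z hyz
      -- What remains avoids the closed neighborhood of `X`, so an uncolorable connected piece has
      -- at most half of `S` and the exponent drops by one.
      obtain ⟨C, hC, hconn, hncol⟩ := exists_isConn_not_colorableOn _ (peel X subset_rfl)
      have hCS : C ⊆ S := hC.trans (Finset.filter_subset _ _)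
      have h2 := hX C hCS hconn fun x hx w hw => (Finset.mem_filter.1 (hC hw)).2 x hx
      have := ih a C D L' (by omega) (by rw [pow_succ] at hcard; omega)
        (fun w hw => hL'D w (hCS hw)) hncol
      exact hcon (hd ▸ this)
    refine key.mono ?_ fun _ => subset_rfl
    rw [hd]
    -- The constant 12 is chosen so that 4(2(d + 1) + 1) ≤ 12(d + 1), the gain from lowering the
    -- exponent by one.
    have : X.card * (2 * (d + 1) + 1) ≤ 4 * (2 * (d + 1) + 1) := Nat.mul_le_mul_right _ hX4
    nlinarith

end Refutation

end ListColoring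

namespace ListColoring

/-! ### Tables of forbidden assignment lists -/

section Table

variable {n k : ℕ}

/-- The digit that stands for giving the color `c` to the vertex `v`; the digits below `k` stand
for nothing. A number in base `(n + 1) * k` thus encodes a list of assignments. -/
def digit (v : Fin n) (c : Fin k) : ℕ := (v + 1) * k + c

theorem digit_lt (v : Fin n) (c : Fin k) : digit v c < (n + 1) * k := by
  have h1 := v.2
  have h2 := c.2
  have : ((v : ℕ) + 1 + 1) * k ≤ (n + 1) * k := Nat.mul_le_mul_right _ (by omega)
  unfold digit
  linarith [Nat.add_mul (v + 1) 1 k]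

theorem digit_div (v : Fin n) (c : Fin k) : digit v c / k = v + 1 := by
  unfold digit
  rw [mul_comm, Nat.mul_add_div (by have := c.2; omega), Nat.div_eq_of_lt c.2, add_zero]

theorem digit_mod (v : Fin n) (c : Fin k) : digit v c % k = c := by
  unfold digit
  rw [mul_comm, Nat.mul_add_mod, Nat.mod_eq_of_lt c.2]

theorem digit_inj {v v' : Fin n} {c c' : Fin k} (h : digit v c = digit v' c') :
    v = v' ∧ c = c' := by
  have h1 := digit_div v c
  have h2 := digit_mod v c
  rw [h, digit_div] at h1
  rw [h, digit_mod] at h2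
  exact ⟨Fin.ext (by omega), Fin.ext h2.symm⟩

variable (n k) in
/-- The table `F` forbids, after the assignments `σ`, all colors at some vertex. -/
def Refuted (F : ℕ → ℕ) (σ : ℕ) : Prop :=
  ∃ u : Fin n, ∀ d : Fin k, F (σ * ((n + 1) * k) + digit u d) ≠ 0

/-- Two assignments exclude each other. -/
def Clash (G : SimpleGraph (Fin n)) (v' : Fin n) (c' : Fin k) (v : Fin n) (c : Fin k) : Prop :=
  (v' = v ∧ c' ≠ c) ∨ (c' = c ∧ G.Adj v' v)

/-- One of the rules by which the table `F` may mark `σ`. A mark at `σ` says that the assignments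
`σ` cannot be extended to a coloring. -/
def Fires (G : SimpleGraph (Fin n)) (L : Fin n → Finset (Fin k)) (F : ℕ → ℕ) (σ : ℕ) : Prop :=
  ∃ v c, σ % ((n + 1) * k) = digit v c ∧
    (c ∉ L v ∨ F (σ / ((n + 1) * k) / ((n + 1) * k) * ((n + 1) * k) + σ % ((n + 1) * k)) ≠ 0 ∨
      (∃ v' c', σ / ((n + 1) * k) % ((n + 1) * k) = digit v' c' ∧ Clash G v' c' v c) ∨
      Refuted n k F σ)

/-- Below `B` no rule adds a mark. -/
def ClosedTable (G : SimpleGraph (Fin n)) (L : Fin n → Finset (Fin k)) (B : ℕ) (F : ℕ → ℕ) : Prop :=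
  ∀ σ < B, Fires G L F σ → F σ ≠ 0

/-- The coloring `f` agrees with the assignments `σ`. -/
def Agrees (f : Fin n → Fin k) (σ : ℕ) : Prop :=
  ∀ i v c, σ / ((n + 1) * k) ^ i % ((n + 1) * k) = digit v c → f v = c

/-- Marks may be missing but are never wrong. Together with closedness this makes the table decide
colorability. -/
def SoundTable (G : SimpleGraph (Fin n)) (L : Fin n → Finset (Fin k)) (F : ℕ → ℕ) : Prop :=
  ∀ σ, F σ ≠ 0 → ∀ f, IsListColoring G L f → ¬ Agrees f σ

theorem agrees_mul_add {f : Fin n → Fin k} {τ r : ℕ} (hr : r < (n + 1) * k) :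
    Agrees f (τ * ((n + 1) * k) + r) ↔ (∀ v c, r = digit v c → f v = c) ∧ Agrees f τ := by
  have h0 : (τ * ((n + 1) * k) + r) % ((n + 1) * k) = r := by
    rw [mul_comm, Nat.mul_add_mod, Nat.mod_eq_of_lt hr]
  have h1 : (τ * ((n + 1) * k) + r) / ((n + 1) * k) = τ := by
    rw [mul_comm, Nat.mul_add_div (by omega), Nat.div_eq_of_lt hr, add_zero]
  constructor
  · intro h
    refine ⟨fun v c hrv => h 0 v c (by simpa [h0] using hrv), fun i v c hi => h (i + 1) v c ?_⟩
    rwa [pow_succ', ← Nat.div_div_eq_div_mul, h1]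
  · rintro ⟨h2, h3⟩ (_ | i) v c hi
    · exact h2 v c (by simpa [h0] using hi)
    · rw [pow_succ', ← Nat.div_div_eq_div_mul, h1] at hi
      exact h3 i v c hi

theorem agrees_iff {f : Fin n → Fin k} (σ : ℕ) (hk : 0 < k) :
    Agrees f σ ↔ (∀ v c, σ % ((n + 1) * k) = digit v c → f v = c) ∧
      Agrees f (σ / ((n + 1) * k)) := by
  conv_lhs => rw [← Nat.div_add_mod' σ ((n + 1) * k)]
  exact agrees_mul_add (Nat.mod_lt _ (by positivity))

theorem agrees_zero (f : Fin n → Fin k) : Agrees f 0 := by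
  intro i v c h
  rw [Nat.zero_div, Nat.zero_mod] at h
  unfold digit at h
  have h2 := c.2
  have : (v + 1) * k ≥ k := Nat.le_mul_of_pos_left k (by omega)
  omega

variable {G : SimpleGraph (Fin n)} {L : Fin n → Finset (Fin k)}

theorem SoundTable.not_agrees_of_refuted {F : ℕ → ℕ} (hF : SoundTable G L F) {σ : ℕ}
    (hσ : Refuted n k F σ) {f : Fin n → Fin k} (hf : IsListColoring G L f) : ¬ Agrees f σ := by
  intro ha
  obtain ⟨u, hu⟩ := hσ
  refine hF _ (hu (f u)) f hf ((agrees_mul_add (digit_lt _ _)).2 ⟨fun v c hvc => ?_, ha⟩)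
  obtain ⟨rfl, rfl⟩ := digit_inj hvc
  rfl

/-- Soundness is stated for a single mark because the sweep writes into the table that it is
reading. Each rule is a valid inference: a wrong color, a list that is already impossible after
dropping an assignment, two contradictory assignments, or a vertex without a color left. -/
theorem SoundTable.update {F : ℕ → ℕ} (hF : SoundTable G L F) {σ : ℕ} (hk : 0 < k)
    (hσ : Fires G L F σ) (x : ℕ) : SoundTable G L (Function.update F σ x) := by
  intro ρ hρ f hf
  by_cases hρσ : ρ = σ
  · subst hρσ
    obtain ⟨v, c, hvc, hrule⟩ := hσ
    intro ha
    have ha' := (agrees_iff ρ hk).1 ha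
    have hfv := ha'.1 v c hvc
    rcases hrule with h | h | ⟨v', c', h1, h2⟩ | h
    · exact h (hfv ▸ hf.2 v)
    · have h3 := (agrees_iff _ hk).1 ha'.2
      exact hF _ h f hf ((agrees_mul_add (Nat.mod_lt _ (by positivity))).2 ⟨ha'.1, h3.2⟩)
    · have h3 := ((agrees_iff _ hk).1 ha'.2).1 v' c' h1
      rcases h2 with ⟨rfl, h4⟩ | ⟨rfl, h4⟩
      · exact h4 (h3 ▸ hfv)
      · exact hf.1 _ _ h4 (h3.trans hfv.symm)
    · exact hF.not_agrees_of_refuted h hf ha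
  · rw [Function.update_of_ne hρσ] at hρ
    exact hF ρ hρ f hf

theorem soundTable_zero : SoundTable G L fun _ => 0 := fun _ h => absurd rfl h

/-- A closed table finds every refutation that fits into it. -/
theorem ClosedTable.refuted {F : ℕ → ℕ} {B : ℕ} (hF : ClosedTable G L B F) {r : ℕ}
    {L' : Fin n → Finset (Fin k)} (h : Refutable G r L') (τ : ℕ)
    -- Every number obtained from `τ` by appending r + 1 digits lies below `B`: `r` digits for the
    -- assignments and one for asking which colors are left.
    (hτ : (τ + 1) * ((n + 1) * k) ^ (r + 1) ≤ B)
    (hL' : ∀ v c, F (τ * ((n + 1) * k) + digit v c) = 0 → c ∈ L' v) : Refuted n k F τ := by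
  induction h generalizing τ with
  | empty v hv =>
    refine ⟨v, fun d hd => ?_⟩
    simpa [hv] using hL' v d hd
  | @branch r L' v c h1 h2 ih1 ih2 =>
    set b := (n + 1) * k with hb
    have hdl : ∀ (w : Fin n) (e : Fin k), digit w e < b := fun w e => digit_lt w e
    have hb0 : 0 < b := (Nat.zero_le _).trans_lt (hdl v c)
    have hbpow : 1 ≤ b ^ r := Nat.one_le_pow _ _ hb0
    have hmod : ∀ (σ : ℕ) (w : Fin n) (e : Fin k), (σ * b + digit w e) % b = digit w e :=
      fun σ w e => by rw [mul_comm, Nat.mul_add_mod, Nat.mod_eq_of_lt (hdl w e)]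
    have hdiv : ∀ (σ : ℕ) (w : Fin n) (e : Fin k), (σ * b + digit w e) / b = σ :=
      fun σ w e => by rw [mul_comm, Nat.mul_add_div hb0, Nat.div_eq_of_lt (hdl w e), add_zero]
    set σ := τ * b + digit v c with hσ
    have hσ1 : σ + 1 ≤ (τ + 1) * b := by
      rw [Nat.add_mul, one_mul]
      have := hdl v c
      omega
    have hσB : (σ + 1) * b ^ (r + 1) ≤ B := by
      refine le_trans (Nat.mul_le_mul_right _ hσ1) (le_trans (le_of_eq ?_) hτ)
      ring
    have hσb : (σ + 1) * b ≤ B := by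
      refine le_trans (Nat.mul_le_mul_left _ ?_) hσB
      calc b = b ^ 1 := (pow_one b).symm
        _ ≤ b ^ (r + 1) := Nat.pow_le_pow_right hb0 (by omega)
    have hσltB : σ < B := by
      have : σ + 1 ≤ (σ + 1) * b := Nat.le_mul_of_pos_right _ hb0
      omega
    -- After appending the assignment (v, c), the rule that drops the second last digit carries over
    -- what was forbidden before, and the clash rule supplies the effect of giving `c` to `v`.
    have hsub : ∀ w e, F (σ * b + digit w e) = 0 → e ∈ assign G L' v c w := by
      intro w e hwe
      have hlt : σ * b + digit w e < B := by
        have := hdl w e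
        rw [Nat.add_mul, one_mul] at hσb
        omega
      have hno := fun hfire => hF _ hlt hfire hwe
      rw [mem_assign]
      refine ⟨hL' w e ?_, ?_, ?_⟩
      · by_contra hne
        refine hno ⟨w, e, hmod σ w e, Or.inr (Or.inl ?_)⟩
        rw [← hb, hdiv, hmod, hσ, hdiv]
        exact hne
      · rintro rfl
        by_contra hne
        refine hno ⟨w, e, hmod σ w e, Or.inr (Or.inr (Or.inl ⟨w, c, ?_, Or.inl ⟨rfl, ?_⟩⟩))⟩
        · rw [← hb, hdiv, hσ, hmod]
        · exact fun he => hne he.symm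
      · rintro hadj rfl
        refine hno ⟨w, e, hmod σ w e, Or.inr (Or.inr (Or.inl ⟨v, e, ?_, Or.inr ⟨rfl, hadj⟩⟩))⟩
        rw [← hb, hdiv, hσ, hmod]
    have href := ih1 σ hσB hsub
    -- The refuted first branch marks `σ`. As a mark one digit beyond `τ`, it forbids `c` at `v`,
    -- which is what the second branch needs, still at `τ` and thus without using up a digit.
    have hmark : F σ ≠ 0 := hF σ hσltB ⟨v, c, hmod τ v c, Or.inr (Or.inr (Or.inr href))⟩
    refine ih2 τ hτ fun w e hwe => mem_remove.2 ⟨hL' w e hwe, ?_⟩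
    rintro rfl rfl
    exact hmark hwe

/-- The number 0 is the empty list of assignments, with which every coloring agrees. Soundness gives
one direction, completeness of closed tables the other. -/
theorem refuted_zero_iff {F : ℕ → ℕ} {B r : ℕ} (hc : ClosedTable G L B F)
    (hs : SoundTable G L F) (hB : ((n + 1) * k) ^ (r + 1) ≤ B)
    (hr : (¬ ∃ f, IsListColoring G L f) → Refutable G r L) :
    Refuted n k F 0 ↔ ¬ ∃ f, IsListColoring G L f := by
  constructor
  · rintro href ⟨f, hf⟩
    exact hs.not_agrees_of_refuted href hf (agrees_zero f)
  · intro hno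
    refine hc.refuted (hr hno) 0 (by simpa using hB) fun v c hvc => ?_
    by_contra hcv
    refine hc (0 * ((n + 1) * k) + digit v c) ?_ ⟨v, c, ?_, Or.inl hcv⟩ hvc
    · have := digit_lt v c
      have h1 : (n + 1) * k ≤ ((n + 1) * k) ^ (r + 1) := Nat.le_self_pow (by omega) _
      omega
    · rw [Nat.zero_mul, zero_add, Nat.mod_eq_of_lt (digit_lt v c)]

theorem IsBullEFree.refutable_of_not_exists (hG : IsBullEFree G) (hk : 0 < k)
    (hL : ¬ ∃ f, IsListColoring G L f) :
    Refutable G n L ∧ ∀ a, n ≤ 2 ^ a → Refutable G (12 * k * (a + k)) L := by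
  have : Nonempty (Fin k) := ⟨⟨0, hk⟩⟩
  have hncol : ¬ ColorableOn G L Finset.univ := by
    rintro ⟨f, h1, h2⟩
    exact hL ⟨f, fun u v => h2 u (by simp) v (by simp), fun v => h1 v (by simp)⟩
  refine ⟨refutable_card_of_not_colorableOn n _ (by simp) L hncol, fun a ha => ?_⟩
  simpa using hG.refutable_of_not_colorableOn _ a Finset.univ Finset.univ L le_rfl (by simpa using ha)
    (fun v _ => Finset.subset_univ _) hncol

end Table

end ListColoring

/-! ### Reasoning about programs, counted loops and arithmetic -/

namespace RAM

@[simp] theorem State.setReg_reg (s : State) (i x j : ℕ) :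
    (s.setReg i x).reg j = if j = i then x else s.reg j := by
  simp [State.setReg, Function.update_apply]

@[simp] theorem State.setReg_mem (s : State) (i x : ℕ) : (s.setReg i x).mem = s.mem := rfl

@[simp] theorem State.setMem_reg (s : State) (a x : ℕ) : (s.setMem a x).reg = s.reg := rfl

@[simp] theorem State.setMem_mem (s : State) (a x : ℕ) :
    (s.setMem a x).mem = Function.update s.mem a x := rfl

theorem State.eq_of {s s' : State} (hr : ∀ i, s.reg i = s'.reg i) (hm : s.mem = s'.mem) :
    s = s' := by
  cases s; cases s'; simp_all [funext_iff]

/-- Started in `s`, the program `P` halts within `T` steps in a state that satisfies `Q`. -/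
def Runs (P : Prog) (s : State) (T : ℕ) (Q : State → Prop) : Prop :=
  ∃ t s', Exec P s t s' ∧ t ≤ T ∧ Q s'

theorem Runs.mono {P : Prog} {s : State} {T T' : ℕ} {Q Q' : State → Prop} (h : Runs P s T Q)
    (hT : T ≤ T') (hQ : ∀ s', Q s' → Q' s') : Runs P s T' Q' := by
  obtain ⟨t, s', h1, h2, h3⟩ := h
  exact ⟨t, s', h1, h2.trans hT, hQ s' h3⟩

theorem Runs.seq {P P' : Prog} {s : State} {T T' : ℕ} {Q : State → Prop}
    (h : Runs P s T fun s' => Runs P' s' T' Q) : Runs (.seq P P') s (T + T') Q := by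
  obtain ⟨t, s', h1, h2, t', s'', h3, h4, h5⟩ := h
  exact ⟨t + t', s'', .seq h1 h3, by omega, h5⟩

theorem Runs.ite {i : ℕ} {P P' : Prog} {s : State} {T : ℕ} {Q : State → Prop}
    (h1 : s.reg i ≠ 0 → Runs P s T Q) (h2 : s.reg i = 0 → Runs P' s T Q) :
    Runs (.ite i P P') s (T + 1) Q := by
  by_cases h : s.reg i = 0
  · obtain ⟨t, s', h3, h4, h5⟩ := h2 h
    exact ⟨t + 1, s', .ite_false h h3, by omega, h5⟩
  · obtain ⟨t, s', h3, h4, h5⟩ := h1 h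
    exact ⟨t + 1, s', .ite_true h h3, by omega, h5⟩

theorem Runs.skip {s : State} {T : ℕ} {Q : State → Prop} (h : Q s) (hT : 1 ≤ T) :
    Runs .skip s T Q := ⟨1, s, .skip s, hT, h⟩

theorem Runs.loop_false {i : ℕ} {P : Prog} {s : State} {T : ℕ} {Q : State → Prop}
    (hi : s.reg i = 0) (h : Q s) (hT : 1 ≤ T) : Runs (.loop i P) s T Q :=
  ⟨1, s, .loop_false hi, hT, h⟩

theorem Runs.loop_true {i : ℕ} {P : Prog} {s : State} {T T' : ℕ} {Q : State → Prop}
    (hi : s.reg i ≠ 0) (h : Runs P s T fun s' => Runs (.loop i P) s' T' Q) :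
    Runs (.loop i P) s (T + T' + 1) Q := by
  obtain ⟨t, s', h1, h2, t', s'', h3, h4, h5⟩ := h
  exact ⟨t + t' + 1, s'', .loop_true hi h1 h3, by omega, h5⟩

/-- The instructions without control flow. -/
inductive Instr : Type
  | const (i c : ℕ) : Instr
  | add (i j l : ℕ) : Instr
  | sub (i j l : ℕ) : Instr
  | load (i j : ℕ) : Instr
  | store (i j : ℕ) : Instr

/-- The effect of an instruction. -/
def Instr.run : Instr → State → State
  | .const i c, s => s.setReg i c
  | .add i j l, s => s.setReg i (s.reg j + s.reg l)
  | .sub i j l, s => s.setReg i (s.reg j - s.reg l)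
  | .load i j, s => s.setReg i (s.mem (s.reg j))
  | .store i j, s => s.setMem (s.reg i) (s.reg j)

/-- An instruction as a program. -/
def Instr.toProg : Instr → Prog
  | .const i c => .const i c
  | .add i j l => .add i j l
  | .sub i j l => .sub i j l
  | .load i j => .load i j
  | .store i j => .store i j

/-- Straight-line programs. -/
def straight : List Instr → Prog
  | [] => .skip
  | c :: l => .seq c.toProg (straight l)

/-- The effect of a straight-line program. -/
def runList : List Instr → State → State
  | [], s => s
  | c :: l, s => runList l (c.run s)

theorem exec_straight (l : List Instr) (s : State) :
    Exec (straight l) s (l.length + 1) (runList l s) := by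
  induction l generalizing s with
  | nil => exact .skip s
  | cons c l ih =>
    have hc : Exec c.toProg s 1 (c.run s) := by
      cases c
      · exact .const ..
      · exact .add ..
      · exact .sub ..
      · exact .load ..
      · exact .store ..
    have := Exec.seq hc (ih (c.run s))
    rwa [show 1 + (l.length + 1) = (c :: l).length + 1 by simp; ring] at this

theorem runs_straight {l : List Instr} {s : State} {T : ℕ} {Q : State → Prop}
    (h : Q (runList l s)) (hT : l.length + 1 ≤ T) : Runs (straight l) s T Q :=
  ⟨_, _, exec_straight l s, hT, h⟩

/-- `for i = 0, ..., reg lim - 1`, run the body. Register `1` holds `1`, and `d` is scratch. -/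
def forLoop (i lim d : ℕ) (body : Prog) : Prog :=
  .seq (straight [.const i 0, .sub d lim i])
    (.loop d (.seq body (straight [.add i i 1, .sub d lim i])))

/-- The invariant rule for counted loops. It is required for every content `x` of `d`, which frees
the body from any bookkeeping; during the loop, `d` holds the number of remaining rounds. Each round
adds four steps to the body. -/
theorem runs_forLoop {i lim d m T : ℕ} {body : Prog} {s : State} {Q : State → Prop}
    (Inv : ℕ → State → Prop) (hil : lim ≠ i) (hdl : lim ≠ d) (hid : i ≠ d)
    (hm : s.reg lim = m) (h0 : Inv 0 ((s.setReg i 0).setReg d m))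
    (hbody : ∀ j < m, ∀ s, Inv j s → s.reg i = j → s.reg lim = m →
      Runs body s T fun s' => s'.reg i = j ∧ s'.reg lim = m ∧ s'.reg 1 = 1 ∧
        ∀ x, Inv (j + 1) ((s'.setReg i (j + 1)).setReg d x))
    (hQ : ∀ s, Inv m s → Q s) : Runs (forLoop i lim d body) s (m * (T + 4) + 4) Q := by
  have key : ∀ l ≤ m, ∀ s : State, s.reg i = m - l → s.reg lim = m → s.reg d = l →
      Inv (m - l) s → Runs (.loop d (.seq body (straight [.add i i 1, .sub d lim i]))) s
        (l * (T + 4) + 1) Q := by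
    intro l
    induction l with
    | zero =>
      intro _ s _ _ hd hI
      exact .loop_false hd (hQ s (by simpa using hI)) (by omega)
    | succ l ih =>
      intro hl s hi hlim hd hI
      refine (Runs.loop_true (T := T + 3) (T' := l * (T + 4) + 1) (by omega) ?_).mono
        (by rw [Nat.add_mul]; omega) fun _ h => h
      refine Runs.seq ((hbody (m - (l + 1)) (by omega) s hI hi hlim).mono le_rfl ?_)
      rintro s' ⟨h1, h2, h3, h4⟩
      refine runs_straight ?_ (by simp)
      have hml : m - (l + 1) + 1 = m - l := by omega
      simp only [runList, Instr.run]
      have hval : (s'.setReg i (s'.reg i + s'.reg 1)).reg lim -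
          (s'.setReg i (s'.reg i + s'.reg 1)).reg i = l := by
        simp [hil, h1, h2, h3]; omega
      rw [hval, h1, h3, hml]
      rw [hml] at h4
      exact ih (by omega) _ (by simp [hid]) (by simp [hil, hdl, h2]) (by simp) (h4 l)
  refine (Runs.seq (T := 3) (runs_straight ?_ (by simp))).mono (T := 3 + (m * (T + 4) + 1))
    (by omega) fun _ h => h
  simp only [runList, Instr.run]
  have hval : (s.setReg i 0).reg lim - (s.setReg i 0).reg i = m := by simp [hil, hm]
  rw [hval]
  exact key m le_rfl _ (by simp [hid]) (by simp [hil, hdl, hm]) (by simp) (by simpa using h0)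

/-- `reg z := reg x * reg y`; the register `e` is scratch and ends with `0`. -/
def mul (z x y e : ℕ) : Prog :=
  .seq (straight [.const z 0, .add e y 0]) (.loop e (straight [.add z z x, .sub e e 1]))

/-- Repeated addition: four steps for each unit of the second factor. -/
theorem runs_mul {z x y e : ℕ} {s : State} {T : ℕ} {Q : State → Prop}
    (hz : z ≠ 0 ∧ z ≠ 1 ∧ z ≠ x ∧ z ≠ y ∧ z ≠ e) (he : e ≠ 0 ∧ e ≠ 1 ∧ e ≠ x)
    (h0 : s.reg 0 = 0) (h1 : s.reg 1 = 1)
    (hQ : Q ((s.setReg z (s.reg x * s.reg y)).setReg e 0))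
    (hT : 4 * s.reg y + 4 ≤ T) : Runs (mul z x y e) s T Q := by
  obtain ⟨hz0, hz1, hzx, hzy, hze⟩ := hz
  obtain ⟨he0, he1, hex⟩ := he
  have key : ∀ j (s : State), s.reg 1 = 1 → s.reg e = j →
      Exec (.loop e (straight [.add z z x, .sub e e 1])) s (4 * j + 1)
        ((s.setReg z (s.reg z + s.reg x * j)).setReg e 0) := by
    intro j
    induction j with
    | zero =>
      intro s _ hj
      convert Exec.loop_false hj using 1
      refine State.eq_of (fun i => ?_) rfl
      simp only [State.setReg_reg]
      split_ifs with h h' <;> simp_all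
    | succ j ih =>
      intro s hs1 hj
      have hstep := exec_straight [.add z z x, .sub e e 1] s
      set s' := runList [.add z z x, .sub e e 1] s with hs'
      have hv : ∀ i, s'.reg i = if i = e then j else if i = z then s.reg z + s.reg x else s.reg i := by
        intro i
        simp only [hs', runList, Instr.run, State.setReg_reg]
        split_ifs <;> simp_all
      have := Exec.loop_true (i := e) (by omega) hstep
        (ih s' (by rw [hv]; simp [hz1.symm, he1.symm, hs1]) (by rw [hv]; simp))
      convert this using 1
      · simp; ring
      · refine State.eq_of (fun i => ?_) rfl
        simp only [State.setReg_reg, hv]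
        split_ifs <;> simp_all
        ring
  have hstart := exec_straight [.const z 0, .add e y 0] s
  set s₀ := runList [.const z 0, .add e y 0] s with hs₀
  have hv : ∀ i, s₀.reg i = if i = e then s.reg y else if i = z then 0 else s.reg i := by
    intro i
    simp only [hs₀, runList, Instr.run, State.setReg_reg, if_neg hzy.symm, if_neg hz0.symm, h0,
      add_zero]
  have hfin := Exec.seq hstart (key (s.reg y) s₀ (by rw [hv]; simp [hz1.symm, he1.symm, h1])
    (by rw [hv]; simp))
  refine ⟨_, _, hfin, by simp; omega, ?_⟩
  convert hQ using 1
  refine State.eq_of (fun i => ?_) rfl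
  simp only [State.setReg_reg, hv]
  split_ifs <;> simp_all

/-- `reg q := reg x / reg y` and `reg r := reg x % reg y`; the register `d` is scratch and ends
with `0`. -/
def divMod (q r d x y : ℕ) : Prog :=
  .seq (straight [.const q 0, .add r x 0, .add d r 1, .sub d d y])
    (.loop d (straight [.sub r r y, .add q q 1, .add d r 1, .sub d d y]))

/-- Repeated subtraction. The test value r + 1 - y is nonzero exactly as long as y ≤ r, and since y
is positive there are at most x rounds. -/
theorem runs_divMod {q r d x y : ℕ} {s : State} {T : ℕ} {Q : State → Prop}
    (hq : q ≠ 0 ∧ q ≠ 1 ∧ q ≠ x ∧ q ≠ y ∧ q ≠ r ∧ q ≠ d)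
    (hr : r ≠ 0 ∧ r ≠ 1 ∧ r ≠ y ∧ r ≠ d) (hd : d ≠ 0 ∧ d ≠ 1 ∧ d ≠ y)
    (h0 : s.reg 0 = 0) (h1 : s.reg 1 = 1) (hy : 0 < s.reg y)
    (hQ : Q (((s.setReg q (s.reg x / s.reg y)).setReg r (s.reg x % s.reg y)).setReg d 0))
    (hT : 6 * s.reg x + 6 ≤ T) : Runs (divMod q r d x y) s T Q := by
  obtain ⟨hq0, hq1, hqx, hqy, hqr, hqd⟩ := hq
  obtain ⟨hr0, hr1, hry, hrd⟩ := hr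
  obtain ⟨hd0, hd1, hdy⟩ := hd
  have key : ∀ j (s : State), s.reg 1 = 1 → 0 < s.reg y → s.reg r / s.reg y = j →
      s.reg d = s.reg r + 1 - s.reg y →
      Exec (.loop d (straight [.sub r r y, .add q q 1, .add d r 1, .sub d d y])) s (6 * j + 1)
        (((s.setReg q (s.reg q + j)).setReg r (s.reg r % s.reg y)).setReg d 0) := by
    intro j
    induction j with
    | zero =>
      intro s _ hy hj hd
      have hlt : s.reg r < s.reg y := (Nat.div_eq_zero_iff.1 hj).resolve_left (by omega)
      have hd' : s.reg d = 0 := by omega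
      convert Exec.loop_false hd' using 1
      refine State.eq_of (fun i => ?_) rfl
      simp only [State.setReg_reg, Nat.mod_eq_of_lt hlt]
      split_ifs <;> simp_all
    | succ j ih =>
      intro s hs1 hy hj hd
      have hle : s.reg y ≤ s.reg r := by
        by_contra hlt
        rw [Nat.div_eq_of_lt (by omega)] at hj
        omega
      have hstep := exec_straight [.sub r r y, .add q q 1, .add d r 1, .sub d d y] s
      set s' := runList [.sub r r y, .add q q 1, .add d r 1, .sub d d y] s with hs'
      have hv : ∀ i, s'.reg i = if i = d then s.reg r - s.reg y + 1 - s.reg y else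
          if i = q then s.reg q + 1 else if i = r then s.reg r - s.reg y else s.reg i := by
        intro i
        simp only [hs', runList, Instr.run, State.setReg_reg, if_neg hqr, if_neg hqr.symm,
          if_neg hr1.symm, if_neg hq1.symm, if_neg hqy.symm, if_neg hry.symm, if_neg hdy.symm, hs1,
          if_true]
        split_ifs <;> rfl
      have hvy : s'.reg y = s.reg y := by
        rw [hv, if_neg hdy.symm, if_neg hqy.symm, if_neg hry.symm]
      have hvr : s'.reg r = s.reg r - s.reg y := by rw [hv, if_neg hrd, if_neg hqr.symm, if_pos rfl]
      have hvq : s'.reg q = s.reg q + 1 := by rw [hv, if_neg hqd, if_pos rfl]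
      have := Exec.loop_true (i := d) (by omega) hstep
        (ih s' (by rw [hv, if_neg hd1.symm, if_neg hq1.symm, if_neg hr1.symm, hs1]) (by omega)
          (by rw [hvr, hvy]; have := Nat.div_eq_sub_div hy hle; omega)
          (by rw [hvr, hvy, hv, if_pos rfl]))
      convert this using 1
      · simp; ring
      · refine State.eq_of (fun i => ?_) rfl
        rw [hvq, hvr, hvy]
        simp only [State.setReg_reg, hv]
        split_ifs <;> first | rfl | (rw [Nat.mod_eq_sub_mod hle]) | omega
  have hstart := exec_straight [.const q 0, .add r x 0, .add d r 1, .sub d d y] s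
  set s₀ := runList [.const q 0, .add r x 0, .add d r 1, .sub d d y] s with hs₀
  have hv : ∀ i, s₀.reg i = if i = d then s.reg x + 1 - s.reg y else if i = r then s.reg x else
      if i = q then 0 else s.reg i := by
    intro i
    simp only [hs₀, runList, Instr.run, State.setReg_reg, if_neg hqx.symm, if_neg hq0.symm,
      if_neg hq1.symm, if_neg hr1.symm, if_neg hdy.symm, if_neg hry.symm, if_neg hqy.symm, h0, h1,
      if_true, add_zero]
    split_ifs <;> rfl
  have hvy : s₀.reg y = s.reg y := by
    rw [hv, if_neg hdy.symm, if_neg hry.symm, if_neg hqy.symm]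
  have hvr : s₀.reg r = s.reg x := by rw [hv, if_neg hrd, if_pos rfl]
  have hvq : s₀.reg q = 0 := by rw [hv, if_neg hqd, if_neg hqr, if_pos rfl]
  have hfin := Exec.seq hstart (key (s.reg x / s.reg y) s₀
    (by rw [hv, if_neg hd1.symm, if_neg hr1.symm, if_neg hq1.symm, h1]) (by omega)
    (by rw [hvr, hvy]) (by rw [hvr, hvy, hv, if_pos rfl]))
  refine ⟨_, _, hfin, ?_, ?_⟩
  · have := Nat.div_le_self (s.reg x) (s.reg y)
    simp only [List.length_cons, List.length_nil]
    omega
  · convert hQ using 1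
    refine State.eq_of (fun i => ?_) rfl
    rw [hvq, hvr, hvy]
    simp only [State.setReg_reg, hv]
    split_ifs <;> simp_all

end RAM

/-! ### Testing whether the table refutes a list -/

namespace ListColoring

open RAM

/-- The registers outside `m, ..., 39` have the same content in both states. -/
def Keep (m : ℕ) (s s' : State) : Prop := ∀ i, i < m ∨ 40 ≤ i → s'.reg i = s.reg i

theorem Keep.refl (m : ℕ) (s : State) : Keep m s s := fun _ _ => rfl

theorem Keep.trans {m m' : ℕ} {s s' s'' : State} (h : Keep m s s') (h' : Keep m' s' s'')
    (hm : m ≤ m') : Keep m s s'' := fun i hi => by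
  rw [h' i (by omega), h i hi]

theorem Keep.setReg {m j : ℕ} {s s' : State} (h : Keep m s s') (hj : m ≤ j ∧ j < 40) (x : ℕ) :
    Keep m s (s'.setReg j x) := fun i hi => by
  rw [State.setReg_reg, if_neg (by omega), h i hi]

/-- With `reg 2 = n`, `reg 3 = k`, `reg 9` the address of a table and `reg 23 = σ * (n + 1) * k`,
decide whether the table refutes `σ`. -/
def checkProg : Prog :=
  -- The pointer starts `k` cells into the block of `σ`, since the digits below `k` stand for
  -- nothing. It then runs through the entries vertex by vertex; register 34 records an unmarked
  -- color in the current row.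
  .seq (straight [.const 32 0, .add 33 9 23, .add 33 33 3])
    (forLoop 30 2 31
      (.seq (straight [.const 34 0])
        (.seq (forLoop 35 3 36
          (.seq (straight [.load 37 33, .add 33 33 1]) (.ite 37 .skip (straight [.const 34 1]))))
          (.ite 34 .skip (straight [.const 32 1])))))

theorem runs_checkRow {s : State} (h1 : s.reg 1 = 1) (h34 : s.reg 34 = 0) :
    Runs (forLoop 35 3 36
      (.seq (straight [.load 37 33, .add 33 33 1]) (.ite 37 .skip (straight [.const 34 1])))) s
      (s.reg 3 * 10 + 4) fun s' => Keep 33 s s' ∧ s'.mem = s.mem ∧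
        s'.reg 33 = s.reg 33 + s.reg 3 ∧
        (s'.reg 34 = 0 ↔ ∀ d < s.reg 3, s.mem (s.reg 33 + d) ≠ 0) := by
  refine (runs_forLoop (T := 6) (fun j s' => Keep 33 s s' ∧ s'.mem = s.mem ∧
    s'.reg 33 = s.reg 33 + j ∧ (s'.reg 34 = 0 ↔ ∀ d < j, s.mem (s.reg 33 + d) ≠ 0))
    (by decide) (by decide) (by decide) rfl ?_ ?_ fun _ h => h)
  · exact ⟨((Keep.refl _ _).setReg (by decide) _).setReg (by decide) _, rfl, by simp, by simp [h34]⟩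
  · rintro j hj s' ⟨hk, hm, hp, hf⟩ hi hl
    have h1' : s'.reg 1 = 1 := by rw [hk 1 (by decide), h1]
    refine Runs.seq (T := 3) (T' := 3) (runs_straight ?_ (by simp))
    simp only [runList, Instr.run]
    refine Runs.ite (T := 2) (fun h => Runs.skip ?_ (by simp))
      (fun h => runs_straight ?_ (by simp))
    · have h' : s.mem (s.reg 33 + j) ≠ 0 := by simpa [hp, hm] using h
      refine ⟨by simpa using hi, by simpa using hl, by simpa using h1', fun x =>
        ⟨(((hk.setReg (by decide) _).setReg (by decide) _).setReg (by decide) _).setReg (by decide)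
          _, hm, ?_, ?_⟩⟩
      · simp [hp, h1']; ring
      · rw [Nat.forall_lt_succ_right, and_iff_left h', ← hf]
        simp
    · have h' : s.mem (s.reg 33 + j) = 0 := by simpa [hp, hm] using h
      simp only [runList, Instr.run]
      refine ⟨by simpa using hi, by simpa using hl, by simpa using h1', fun x =>
        ⟨((((hk.setReg (by decide) _).setReg (by decide) _).setReg (by decide) _).setReg (by decide)
          _).setReg (by decide) _, hm, ?_, ?_⟩⟩
      · simp [hp, h1']; ring
      · simp only [State.setReg_reg]
        norm_num
        exact ⟨j, by omega, h'⟩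

theorem runs_checkProg {s : State} {T : ℕ} {Q : State → Prop} (h1 : s.reg 1 = 1)
    (hQ : ∀ s', Keep 30 s s' → s'.mem = s.mem →
      (s'.reg 32 ≠ 0 ↔ ∃ u < s.reg 2, ∀ d < s.reg 3,
        s.mem (s.reg 9 + s.reg 23 + s.reg 3 + u * s.reg 3 + d) ≠ 0) → Q s')
    (hT : s.reg 2 * (s.reg 3 * 10 + 13) + 8 ≤ T) : Runs checkProg s T Q := by
  refine (Runs.seq (T := 4) (T' := s.reg 2 * (s.reg 3 * 10 + 9 + 4) + 4)
    (runs_straight ?_ (by simp))).mono (by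
      rw [show s.reg 3 * 10 + 9 + 4 = s.reg 3 * 10 + 13 by ring]; omega) fun _ h => h
  set p := s.reg 9 + s.reg 23 + s.reg 3 with hp
  simp only [runList, Instr.run]
  refine (runs_forLoop (m := s.reg 2) (fun u s' => Keep 30 s s' ∧ s'.mem = s.mem ∧
    s'.reg 33 = p + u * s.reg 3 ∧
      (s'.reg 32 ≠ 0 ↔ ∃ u' < u, ∀ d < s.reg 3, s.mem (p + u' * s.reg 3 + d) ≠ 0))
    (by decide) (by decide) (by decide) (by simp) ?_ ?_ fun s' h => hQ s' h.1 h.2.1 h.2.2.2)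
  · refine ⟨?_, rfl, by simp [hp], by simp⟩
    exact (((((Keep.refl _ _).setReg (by decide) _).setReg (by decide) _).setReg (by decide)
      _).setReg (by decide) _).setReg (by decide) _
  · rintro u hu s' ⟨hk, hm, hpu, hf⟩ hi hl
    have e1 : s'.reg 1 = 1 := by rw [hk 1 (by decide), h1]
    have e3 : s'.reg 3 = s.reg 3 := hk 3 (by decide)
    refine (Runs.seq (T := 2) (T' := s.reg 3 * 10 + 4 + 3) (runs_straight ?_ (by simp))).mono
      (by omega) fun _ h => h
    simp only [runList, Instr.run]
    have hrow := runs_checkRow (s := s'.setReg 34 0) (by simp [e1]) (by simp)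
    simp only [State.setReg_reg, State.setReg_mem, e3, hm] at hrow
    norm_num at hrow
    refine Runs.seq (hrow.mono le_rfl ?_)
    rintro s'' ⟨hk'', hm'', hp'', hf''⟩
    have hk3 : Keep 30 s s'' := (hk.setReg (by decide) _).trans hk'' (by decide)
    have f30 : s''.reg 30 = u := by rw [hk'' 30 (by decide)]; simpa using hi
    have f2 : s''.reg 2 = s.reg 2 := hk3 2 (by decide)
    have f1 : s''.reg 1 = 1 := by rw [hk3 1 (by decide), h1]
    have f32 : s''.reg 32 = s'.reg 32 := by rw [hk'' 32 (by decide)]; simp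
    rw [hpu] at hp'' hf''
    refine Runs.ite (T := 2) (fun h => Runs.skip ?_ (by simp))
      (fun h => runs_straight ?_ (by simp))
    · refine ⟨f30, f2, f1, fun x => ⟨(hk3.setReg (by decide) _).setReg (by decide) _, hm'', ?_, ?_⟩⟩
      · simp [hp'']; ring
      · have hn := mt hf''.2 h
        rw [Nat.exists_lt_succ_right, or_iff_left hn, ← hf, ← f32]
        simp
    · simp only [runList, Instr.run]
      refine ⟨by simp [f30], by simp [f2], by simp [f1], fun x =>
        ⟨((hk3.setReg (by decide) _).setReg (by decide) _).setReg (by decide) _, hm'', ?_, ?_⟩⟩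
      · simp [hp'']; ring
      · simp only [State.setReg_reg]
        norm_num
        exact ⟨u, by omega, by simpa using hf''.1 h⟩

end ListColoring

/-! ### Evaluating the rules -/

namespace ListColoring

open RAM

/-- With the base `(n + 1) * k` in `reg 4`, split the content of `reg 11` into its last two digits
(`reg 14` and `reg 18`) and the rest, and the digits into a vertex and a color. -/
def decodeProg : Prog :=
  .seq (divMod 13 14 29 11 4) (.seq (divMod 17 18 29 13 4)
    (.seq (divMod 15 16 29 14 3) (divMod 19 20 29 18 3)))

theorem runs_decodeProg {s : State} {T : ℕ} {Q : State → Prop} (h0 : s.reg 0 = 0)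
    (h1 : s.reg 1 = 1) (h3 : 0 < s.reg 3) (h4 : 0 < s.reg 4)
    (hQ : ∀ s', Keep 13 s s' → s'.mem = s.mem → s'.reg 13 = s.reg 11 / s.reg 4 →
      s'.reg 14 = s.reg 11 % s.reg 4 → s'.reg 15 = s.reg 11 % s.reg 4 / s.reg 3 →
      s'.reg 16 = s.reg 11 % s.reg 4 % s.reg 3 → s'.reg 18 = s.reg 11 / s.reg 4 % s.reg 4 →
      s'.reg 19 = s.reg 11 / s.reg 4 % s.reg 4 / s.reg 3 →
      s'.reg 20 = s.reg 11 / s.reg 4 % s.reg 4 % s.reg 3 → Q s')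
    (hT : 24 * s.reg 11 + 24 ≤ T) : Runs decodeProg s T Q := by
  have b1 : s.reg 11 / s.reg 4 ≤ s.reg 11 := Nat.div_le_self _ _
  have b2 : s.reg 11 % s.reg 4 ≤ s.reg 11 := Nat.mod_le _ _
  have b3 : s.reg 11 / s.reg 4 % s.reg 4 ≤ s.reg 11 := (Nat.mod_le _ _).trans b1
  refine (Runs.seq (T := 6 * s.reg 11 + 6) (T' := 6 * s.reg 11 + 6 + (6 * s.reg 11 + 6 +
    (6 * s.reg 11 + 6))) ?_).mono (by omega) fun _ h => h
  refine runs_divMod (by decide) (by decide) (by decide) h0 h1 h4 ?_ le_rfl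
  refine Runs.seq ?_
  refine runs_divMod (by decide) (by decide) (by decide) (by simpa using h0) (by simpa using h1)
    (by simpa using h4) ?_ (by simpa using b1)
  refine Runs.seq ?_
  refine runs_divMod (by decide) (by decide) (by decide) (by simpa using h0) (by simpa using h1)
    (by simpa using h3) ?_ (by simpa using b2)
  refine runs_divMod (by decide) (by decide) (by decide) (by simpa using h0) (by simpa using h1)
    (by simpa using h3) ?_ (by simpa using b3)
  refine hQ _ (fun i hi => ?_) ?_ ?_ ?_ ?_ ?_ ?_ ?_ ?_ <;> simp
  repeat' rw [if_neg (by omega)]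

/-- After `decodeProg` and with the content of `reg 11` multiplied by `reg 4` in `reg 23`, compute
in `reg 25` whether one of the rules other than those about clashes applies, and prepare the
comparison of the last two digits. -/
def gatherList : List Instr :=
  -- Subtracting a list entry from 1 flags its absence. The next address is that of the number
  -- without its second last digit. Summing both truncated differences gives a value that vanishes
  -- exactly on equality, for the vertices in register 26 and the colors in 27; register 28 receives
  -- the adjacency entry. Digits carry the vertex number plus one, hence the corrections by `k` and
  -- `n`.
  [.add 26 5 14, .sub 26 26 3, .load 25 26, .sub 25 1 25,
    .sub 26 13 18, .add 26 26 14, .add 26 26 9, .load 27 26, .add 25 25 27, .add 25 25 32,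
    .sub 26 15 19, .sub 27 19 15, .add 26 26 27, .sub 27 16 20, .sub 28 20 16, .add 27 27 28,
    .add 28 24 15, .sub 28 28 2, .load 28 28]

theorem add_ne_zero_iff' (a b : ℕ) : a + b ≠ 0 ↔ a ≠ 0 ∨ b ≠ 0 := by omega

theorem or_rotate_iff {a b c d : Prop} : ((a ∨ b ∨ d) ∨ c) ↔ (a ∨ b ∨ c ∨ d) := by tauto

/-- After `decodeProg`, compute in `reg 25` whether one of the rules applies. -/
def ruleProg : Prog :=
  .seq (mul 23 11 4 29) (.seq checkProg (.seq (mul 24 2 19 29) (.seq (straight gatherList)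
    -- Register 19 is zero if the second last digit stands for nothing, and then no clash is
    -- possible.
    (.ite 19 (.ite 26 (.ite 27 .skip (straight [.add 25 25 28])) (straight [.add 25 25 27]))
      .skip))))

theorem runs_ruleProg {s : State} {T : ℕ} {Q : State → Prop} (h0 : s.reg 0 = 0)
    (h1 : s.reg 1 = 1)
    (hQ : ∀ s', Keep 13 s s' → s'.mem = s.mem → (s'.reg 25 ≠ 0 ↔
      s.mem (s.reg 5 + s.reg 14 - s.reg 3) = 0 ∨
      s.mem (s.reg 13 - s.reg 18 + s.reg 14 + s.reg 9) ≠ 0 ∨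
      (s.reg 19 ≠ 0 ∧ ((s.reg 19 = s.reg 15 ∧ s.reg 20 ≠ s.reg 16) ∨ (s.reg 19 ≠ s.reg 15 ∧
        s.reg 20 = s.reg 16 ∧ s.mem (s.reg 2 * s.reg 19 + s.reg 15 - s.reg 2) ≠ 0))) ∨
      ∃ u < s.reg 2, ∀ d < s.reg 3,
        s.mem (s.reg 9 + s.reg 11 * s.reg 4 + s.reg 3 + u * s.reg 3 + d) ≠ 0) → Q s')
    (hT : 4 * s.reg 4 + 4 * s.reg 19 + s.reg 2 * (s.reg 3 * 10 + 13) + 50 ≤ T) :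
    Runs ruleProg s T Q := by
  refine (Runs.seq (T := 4 * s.reg 4 + 4) (T' := s.reg 2 * (s.reg 3 * 10 + 13) + 8 +
    (4 * s.reg 19 + 4 + (20 + 5))) ?_).mono (by omega) fun _ h => h
  refine runs_mul (by decide) (by decide) h0 h1 ?_ le_rfl
  refine Runs.seq ?_
  refine runs_checkProg (by simpa using h1) ?_ (by simp)
  intro s₁ hk₁ hm₁ hf₁
  simp only [State.setReg_reg, State.setReg_mem] at hm₁ hf₁
  norm_num at hf₁
  have e : ∀ i, i < 23 → s₁.reg i = s.reg i := fun i hi => by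
    rw [hk₁ i (by omega), State.setReg_reg, if_neg (by omega), State.setReg_reg, if_neg (by omega)]
  have hk : Keep 13 s s₁ :=
    (((Keep.refl _ _).setReg (by decide) _).setReg (by decide) _).trans hk₁ (by decide)
  refine Runs.seq ?_
  refine runs_mul (by decide) (by decide) (by rw [e 0 (by decide), h0])
    (by rw [e 1 (by decide), h1]) ?_ (by rw [e 19 (by decide)])
  set s₂ := (s₁.setReg 24 (s₁.reg 2 * s₁.reg 19)).setReg 29 0 with hs₂
  have e' : ∀ i, i < 23 → s₂.reg i = s.reg i := fun i hi => by
    rw [hs₂, State.setReg_reg, if_neg (by omega), State.setReg_reg, if_neg (by omega), e i hi]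
  have e24 : s₂.reg 24 = s.reg 2 * s.reg 19 := by simp [hs₂, e]
  have e32 : s₂.reg 32 = s₁.reg 32 := by simp [hs₂]
  have hk₂ : Keep 13 s s₂ := (hk.setReg (by decide) _).setReg (by decide) _
  have hm₂ : s₂.mem = s.mem := hm₁
  clear_value s₂
  refine Runs.seq (runs_straight (T := 20) ?_ (by simp [gatherList]))
  set s₃ := runList gatherList s₂ with hs₃
  have hm₃ : s₃.mem = s.mem := hm₂
  have hk₃ : Keep 13 s s₃ := by
    refine hk₂.trans (m' := 13) (fun i hi => ?_) le_rfl
    have : 13 ≤ 25 ∧ 28 < 40 := by decide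
    simp only [hs₃, gatherList, runList, Instr.run, State.setReg_reg]
    repeat' rw [if_neg (by omega)]
  have e19 : s₃.reg 19 = s.reg 19 := by
    simp [hs₃, gatherList, runList, Instr.run, e']
  have e25 : s₃.reg 25 = 1 - s.mem (s.reg 5 + s.reg 14 - s.reg 3) +
      s.mem (s.reg 13 - s.reg 18 + s.reg 14 + s.reg 9) + s₁.reg 32 := by
    simp [hs₃, gatherList, runList, Instr.run, e', hm₂, e32, h1]
  have e26 : s₃.reg 26 = s.reg 15 - s.reg 19 + (s.reg 19 - s.reg 15) := by
    simp [hs₃, gatherList, runList, Instr.run, e']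
  have e27 : s₃.reg 27 = s.reg 16 - s.reg 20 + (s.reg 20 - s.reg 16) := by
    simp [hs₃, gatherList, runList, Instr.run, e']
  have e28 : s₃.reg 28 = s.mem (s.reg 2 * s.reg 19 + s.reg 15 - s.reg 2) := by
    simp [hs₃, gatherList, runList, Instr.run, e', hm₂, e24]
  clear_value s₃
  have hbase : s₃.reg 25 ≠ 0 ↔ s.mem (s.reg 5 + s.reg 14 - s.reg 3) = 0 ∨
      s.mem (s.reg 13 - s.reg 18 + s.reg 14 + s.reg 9) ≠ 0 ∨
      ∃ u < s.reg 2, ∀ d < s.reg 3,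
        s.mem (s.reg 9 + s.reg 11 * s.reg 4 + s.reg 3 + u * s.reg 3 + d) ≠ 0 := by
    rw [e25, ← hf₁]
    omega
  refine Runs.ite (T := 4) (fun h19 => Runs.ite (T := 3) (fun h26 => Runs.ite (T := 2)
    (fun h27 => Runs.skip ?_ (by simp)) fun h27 => runs_straight ?_ (by simp))
    fun h26 => runs_straight ?_ (by simp)) fun h19 => Runs.skip ?_ (by simp)
  · refine hQ _ hk₃ hm₃ (hbase.trans ?_)
    rw [e19] at h19
    rw [e26] at h26
    rw [e27] at h27
    have a1 : s.reg 19 ≠ s.reg 15 := fun h => h26 (by rw [h, Nat.sub_self])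
    have a2 : s.reg 20 ≠ s.reg 16 := fun h => h27 (by rw [h, Nat.sub_self])
    simp [a1, a2]
  · refine hQ _ (hk₃.setReg (by decide) _) hm₃ ?_
    rw [e19] at h19
    rw [e26] at h26
    rw [e27] at h27
    have a1 : s.reg 19 ≠ s.reg 15 := fun h => h26 (by rw [h, Nat.sub_self])
    have a2 : s.reg 20 = s.reg 16 := by clear hbase hf₁ hQ; omega
    have : (runList [.add 25 25 28] s₃).reg 25 = s₃.reg 25 + s₃.reg 28 := by
      simp [runList, Instr.run]
    rw [this, e28, add_ne_zero_iff', hbase]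
    simp only [a1, a2, h19, ne_eq, not_true, and_false, not_false_eq_true, true_and, false_or]
    exact or_rotate_iff
  · refine hQ _ (hk₃.setReg (by decide) _) hm₃ ?_
    rw [e19] at h19
    rw [e26] at h26
    have a1 : s.reg 19 = s.reg 15 := by clear hbase hf₁ hQ; omega
    have : (runList [.add 25 25 27] s₃).reg 25 = s₃.reg 25 + s₃.reg 27 := by
      simp [runList, Instr.run]
    have a2 : s₃.reg 27 ≠ 0 ↔ s.reg 20 ≠ s.reg 16 := by rw [e27]; clear hbase hf₁ hQ; omega
    rw [this, add_ne_zero_iff', hbase, a2]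
    simp only [← a1, h19, ne_eq, not_true, not_false_eq_true, true_and, false_and, or_false]
    exact or_rotate_iff
  · refine hQ _ hk₃ hm₃ (hbase.trans ?_)
    rw [e19] at h19
    simp [h19]

/-- Apply the rules to the number in `reg 11`; if a mark is added, set `reg 10` to `1`. -/
def bodyProg : Prog :=
  .seq decodeProg (.ite 15 (.seq ruleProg (.ite 25 (.seq (straight [.add 26 9 11, .load 27 26])
    (.ite 27 .skip (straight [.store 26 1, .const 10 1]))) .skip)) .skip)

end ListColoring

/-! ### The programs match the rules of the table -/

namespace ListColoring

open RAM

variable {n k : ℕ}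

/-- The memory `M` holds the adjacency matrix of `G` and the incidence matrix of `L`. -/
def Encodes (G : SimpleGraph (Fin n)) (L : Fin n → Finset (Fin k)) (M : ℕ → ℕ) : Prop :=
  (∀ u v : Fin n, M (1 + n * u + v) ≠ 0 ↔ G.Adj u v) ∧
    ∀ (v : Fin n) (c : Fin k), M (1 + n * n + k * v + c) ≠ 0 ↔ c ∈ L v

theorem exists_eq_digit {r : ℕ} (hr : r < (n + 1) * k) (h0 : r / k ≠ 0) :
    ∃ (v : Fin n) (c : Fin k), r = digit v c := by
  have hk : 0 < k := by
    rcases Nat.eq_zero_or_pos k with rfl | h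
    · simp at hr
    · exact h
  have h1 : r / k < n + 1 := Nat.div_lt_of_lt_mul (by rwa [mul_comm] at hr)
  obtain ⟨q, hq⟩ := Nat.exists_eq_succ_of_ne_zero h0
  refine ⟨⟨q, by omega⟩, ⟨r % k, Nat.mod_lt _ hk⟩, ?_⟩
  have h2 := Nat.div_add_mod' r k
  rw [hq] at h2
  exact h2.symm

theorem digit_div_ne_zero (v : Fin n) (c : Fin k) : digit v c / k ≠ 0 := by
  rw [digit_div]; omega

/-- A graph has no loops, so the adjacency case may assume different vertices; this is the form of
the nested tests in the program. -/
theorem clash_iff {G : SimpleGraph (Fin n)} {L : Fin n → Finset (Fin k)} {M : ℕ → ℕ}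
    (hM : Encodes G L M) {r' : ℕ} (hr' : r' < (n + 1) * k) (v : Fin n) (c : Fin k) :
    (∃ v' c', r' = digit v' c' ∧ Clash G v' c' v c) ↔ r' / k ≠ 0 ∧
      ((r' / k = v + 1 ∧ r' % k ≠ c) ∨
        (r' / k ≠ v + 1 ∧ r' % k = c ∧ M (n * (r' / k) + (v + 1) - n) ≠ 0)) := by
  have key : ∀ v' c', Clash G v' c' v c ↔ ((digit v' c' / k = v + 1 ∧ digit v' c' % k ≠ c) ∨
      (digit v' c' / k ≠ v + 1 ∧ digit v' c' % k = c ∧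
        M (n * (digit v' c' / k) + (v + 1) - n) ≠ 0)) := by
    intro v' c'
    rw [digit_div, digit_mod, show n * ((v' : ℕ) + 1) + (v + 1) - n = 1 + n * v' + v by
      rw [Nat.mul_add]; omega, hM.1, Clash]
    simp only [Nat.add_right_cancel_iff, Fin.val_inj, ne_eq]
    refine or_congr_right ⟨fun h => ⟨?_, h⟩, fun h => h.2⟩
    rintro rfl
    exact G.loopless.irrefl _ h.2
  constructor
  · rintro ⟨v', c', rfl, h⟩
    exact ⟨digit_div_ne_zero _ _, (key v' c').1 h⟩
  · rintro ⟨h0, h⟩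
    obtain ⟨v', c', rfl⟩ := exists_eq_digit hr' h0
    exact ⟨v', c', rfl, (key v' c').2 h⟩

theorem refuted_iff (F : ℕ → ℕ) (σ : ℕ) : Refuted n k F σ ↔
    ∃ u < n, ∀ d < k, F (σ * ((n + 1) * k) + k + u * k + d) ≠ 0 := by
  have key : ∀ (u : Fin n) (d : Fin k), σ * ((n + 1) * k) + digit u d =
      σ * ((n + 1) * k) + k + u * k + d := fun u d => by unfold digit; ring
  constructor
  · rintro ⟨u, hu⟩
    exact ⟨u, u.2, fun d hd => key u ⟨d, hd⟩ ▸ hu ⟨d, hd⟩⟩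
  · rintro ⟨u, hu, h⟩
    exact ⟨⟨u, hu⟩, fun d => by rw [key]; exact h d d.2⟩

/-- The rules in terms of the addresses that the program reads. A nonzero quotient by `k` singles
out the digits that stand for an assignment, and `τ - r' + r` is `σ` with its second last digit
deleted. -/
theorem fires_iff {G : SimpleGraph (Fin n)} {L : Fin n → Finset (Fin k)} {M : ℕ → ℕ}
    (hM : Encodes G L M) (hk : 0 < k) (T σ b r τ r' : ℕ) (hb : b = (n + 1) * k) (hr : r = σ % b)
    (hτ : τ = σ / b) (hr' : r' = τ % b) :
    Fires G L (fun ρ => M (T + ρ)) σ ↔ r / k ≠ 0 ∧ (M (1 + n * n + r - k) = 0 ∨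
      M (τ - r' + r + T) ≠ 0 ∨
      (r' / k ≠ 0 ∧ ((r' / k = r / k ∧ r' % k ≠ r % k) ∨
        (r' / k ≠ r / k ∧ r' % k = r % k ∧ M (n * (r' / k) + r / k - n) ≠ 0))) ∨
      ∃ u < n, ∀ d < k, M (T + σ * b + k + u * k + d) ≠ 0) := by
  have hb0 : 0 < b := by rw [hb]; positivity
  have hrb : r < (n + 1) * k := by rw [hr, ← hb]; exact Nat.mod_lt _ hb0
  have hrb' : r' < (n + 1) * k := by rw [hr', ← hb]; exact Nat.mod_lt _ hb0
  have hdiv : τ / b * b = τ - r' := by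
    have := Nat.div_add_mod' τ b
    omega
  have key : ∀ v c, r = digit v c → ((c ∉ L v ∨
      M (T + (τ / b * b + r)) ≠ 0 ∨ (∃ v' c', r' = digit v' c' ∧ Clash G v' c' v c) ∨
        Refuted n k (fun ρ => M (T + ρ)) σ) ↔ (M (1 + n * n + r - k) = 0 ∨
      M (τ - r' + r + T) ≠ 0 ∨
      (r' / k ≠ 0 ∧ ((r' / k = r / k ∧ r' % k ≠ r % k) ∨
        (r' / k ≠ r / k ∧ r' % k = r % k ∧ M (n * (r' / k) + r / k - n) ≠ 0))) ∨
      ∃ u < n, ∀ d < k, M (T + σ * b + k + u * k + d) ≠ 0)) := by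
    intro v c hvc
    have h1 : c ∉ L v ↔ M (1 + n * n + r - k) = 0 := by
      rw [← hM.2 v c, not_not, hvc, show 1 + n * n + digit v c - k = 1 + n * n + k * v + c by
        unfold digit; rw [Nat.add_mul, mul_comm k]; omega]
    have h2 : T + (τ / b * b + r) = τ - r' + r + T := by rw [hdiv]; ring
    rw [h1, h2, clash_iff hM hrb', refuted_iff]
    rw [hvc, digit_div, digit_mod, ← hb]
    simp only [← add_assoc]
  unfold Fires
  rw [← hb, ← hτ, ← hr, ← hr']
  constructor
  · rintro ⟨v, c, hvc, h⟩
    exact ⟨hvc ▸ digit_div_ne_zero v c, (key v c hvc).1 h⟩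
  · rintro ⟨h0, h⟩
    obtain ⟨v, c, hvc⟩ := exists_eq_digit hrb h0
    exact ⟨v, c, hvc, (key v c hvc).2 h⟩

/-- The constants that the program keeps in its registers. -/
structure Ready (n k T : ℕ) (s : State) : Prop where
  zero : s.reg 0 = 0
  one : s.reg 1 = 1
  card : s.reg 2 = n
  colors : s.reg 3 = k
  base : s.reg 4 = (n + 1) * k
  lists : s.reg 5 = 1 + n * n
  table : s.reg 9 = T

theorem Ready.keep {T m : ℕ} {s s' : State} (h : Ready n k T s) (hs : Keep m s s')
    (hm : 10 ≤ m) : Ready n k T s' := by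
  obtain ⟨h0, h1, h2, h3, h4, h5, h9⟩ := h
  constructor <;> rw [hs _ (by omega)] <;> assumption

theorem runs_bodyProg {G : SimpleGraph (Fin n)} {L : Fin n → Finset (Fin k)} {T σ : ℕ} {s : State}
    {Q : State → Prop} (hs : Ready n k T s) (hσ : s.reg 11 = σ) (hM : Encodes G L s.mem)
    (hk : 0 < k)
    (hstay : (Fires G L (fun ρ => s.mem (T + ρ)) σ → s.mem (T + σ) ≠ 0) →
      ∀ s', Keep 13 s s' → s'.mem = s.mem → Q s')
    (hmark : Fires G L (fun ρ => s.mem (T + ρ)) σ → s.mem (T + σ) = 0 →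
      ∀ s', Keep 13 (s.setReg 10 1) s' → s'.mem = Function.update s.mem (T + σ) 1 → Q s')
    {t : ℕ} (ht : 24 * σ + 8 * ((n + 1) * k) + n * (k * 10 + 13) + 90 ≤ t) :
    Runs bodyProg s t Q := by
  have hb0 : 0 < (n + 1) * k := by positivity
  refine (Runs.seq (T := 24 * σ + 24) (T' := (4 * ((n + 1) * k) + 4 * ((n + 1) * k) +
    n * (k * 10 + 13) + 50) + 8 + 1) ?_).mono (by omega) fun _ h => h
  refine runs_decodeProg hs.zero hs.one (by rw [hs.colors]; exact hk) (by rw [hs.base]; exact hb0)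
    ?_ (by rw [hσ])
  rw [hσ, hs.base, hs.colors]
  intro s₁ hk₁ hm₁ e13 e14 e15 e16 e18 e19 e20
  have hr₁ := hs.keep hk₁ (by decide)
  have e11 : s₁.reg 11 = σ := by rw [hk₁ 11 (by decide), hσ]
  have hfires := fires_iff hM hk T σ _ _ _ _ rfl e14 e13 
    (e18.trans (by rw [e13]))
  refine Runs.ite (fun h15 => ?_) (fun h15 => ?_)
  swap
  · refine Runs.skip (hstay (fun hf => ?_) _ hk₁ hm₁) (by omega)
    exact absurd (e15.symm.trans h15) (by rw [← e14]; exact (hfires.1 hf).1)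
  refine Runs.seq (T := 4 * ((n + 1) * k) + 4 * ((n + 1) * k) + n * (k * 10 + 13) + 50) (T' := 8) ?_
  refine runs_ruleProg hr₁.zero hr₁.one ?_ ?_
  swap
  · rw [hr₁.base, hr₁.card, hr₁.colors, e19]
    have := (Nat.div_le_self (σ / ((n + 1) * k) % ((n + 1) * k)) k).trans (Nat.mod_lt _ hb0).le
    clear hfires e13 e14 e15 e16 e18 e19 e20
    omega
  rw [hr₁.lists, hr₁.colors, hr₁.table, hr₁.card, e11, hr₁.base, hm₁]
  intro s₂ hk₂ hm₂ hflag
  rw [e15, e16, e19, e20, ← e14, ← e18] at hflag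
  have hflag' : s₂.reg 25 ≠ 0 ↔ Fires G L (fun ρ => s.mem (T + ρ)) σ := by
    refine hflag.trans ((and_iff_right ?_).symm.trans hfires.symm)
    rw [e14, ← e15]
    exact h15
  have hk₂' := hk₁.trans hk₂ le_rfl
  have hr₂ := hs.keep hk₂' (by decide)
  have f11 : s₂.reg 11 = σ := by rw [hk₂' 11 (by decide), hσ]
  refine Runs.ite (T := 7) (fun h25 => ?_) fun h25 => Runs.skip (hstay (fun hf => ?_) _ hk₂' hm₂)
    (by decide)
  swap
  · exact absurd h25 (hflag'.2 hf)
  refine Runs.seq (T := 3) (T' := 4) (runs_straight ?_ (by simp))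
  simp only [runList, Instr.run]
  have hv : (s₂.setReg 26 (s₂.reg 9 + s₂.reg 11)).mem
      ((s₂.setReg 26 (s₂.reg 9 + s₂.reg 11)).reg 26) = s.mem (T + σ) := by
    simp [hm₂, hr₂.table, f11]
  rw [hv, hr₂.table, f11]
  have hk₃ : Keep 13 s ((s₂.setReg 26 (T + σ)).setReg 27 (s.mem (T + σ))) :=
    (hk₂'.setReg (by decide) _).setReg (by decide) _
  refine Runs.ite (T := 3) (fun h27 => Runs.skip (hstay (fun hf => ?_) _ hk₃ hm₂) (by decide))
    fun h27 => runs_straight (hmark (hflag'.1 h25) ?_ _ (fun i hi => ?_) ?_) (by simp)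
  · simpa using h27
  · simpa using h27
  · simp only [runList, Instr.run, State.setReg_reg, State.setMem_reg]
    split_ifs
    · rfl
    · omega
    · omega
    · exact hk₂' i hi
  · simp [runList, Instr.run, hm₂, hr₂.one]

end ListColoring

/-! ### Sweeping the table until it is closed -/

namespace ListColoring

open RAM

variable {n k : ℕ} {G : SimpleGraph (Fin n)} {L : Fin n → Finset (Fin k)}

theorem Encodes.congr {M M' : ℕ → ℕ} (h : Encodes G L M)
    (hM : ∀ a < 1 + n * n + n * k, M' a = M a) : Encodes G L M' := by
  refine ⟨fun u v => ?_, fun v c => ?_⟩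
  · rw [hM, h.1]
    have h1 : n * (u + 1) ≤ n * n := Nat.mul_le_mul_left _ u.2
    have h2 := v.2
    rw [Nat.mul_add] at h1
    omega
  · rw [hM, h.2]
    have h1 : k * (v + 1) ≤ k * n := Nat.mul_le_mul_left _ v.2
    have h2 := c.2
    rw [Nat.mul_add, mul_comm k n] at h1
    omega

/-- The time for applying the rules to a number below `B`. -/
def bodyCost (n k B : ℕ) : ℕ := 24 * B + 8 * ((n + 1) * k) + n * (k * 10 + 13) + 90

/-- Apply the rules once to all numbers below the content of `reg 7`. -/
def sweepProg : Prog := forLoop 11 7 12 bodyProg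

/-- What the program `sweepProg` has done before it comes to the number `j`. -/
structure Swept (G : SimpleGraph (Fin n)) (L : Fin n → Finset (Fin k)) (T B : ℕ) (s : State)
    (j : ℕ) (s' : State) : Prop where
  keep : Keep 10 s s'
  outside : ∀ a, a < T ∨ T + B ≤ a → s'.mem a = s.mem a
  sound : SoundTable G L fun ρ => s'.mem (T + ρ)
  marked : ∀ a, s.mem a ≠ 0 → s'.mem a ≠ 0
  progress : (s'.reg 10 = 0 ∧ s'.mem = s.mem ∧
      ∀ σ < j, Fires G L (fun ρ => s.mem (T + ρ)) σ → s.mem (T + σ) ≠ 0) ∨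
    (s'.reg 10 ≠ 0 ∧ ∃ σ < B, s.mem (T + σ) = 0 ∧ s'.mem (T + σ) ≠ 0)

theorem Swept.of_regs {T B j : ℕ} {s s' s'' : State} (h : Swept G L T B s j s')
    (hk : Keep 11 s' s'') (hm : s''.mem = s'.mem) : Swept G L T B s j s'' := by
  obtain ⟨h1, h2, h3, h4, h5⟩ := h
  refine ⟨h1.trans hk (by decide), ?_, ?_, ?_, ?_⟩
  · rwa [hm]
  · rwa [hm]
  · rwa [hm]
  · rwa [hm, hk 10 (by decide)]

theorem Swept.stay {T B j : ℕ} {s s' : State} (h : Swept G L T B s j s')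
    (hj : Fires G L (fun ρ => s'.mem (T + ρ)) j → s'.mem (T + j) ≠ 0) :
    Swept G L T B s (j + 1) s' := by
  obtain ⟨h1, h2, h3, h4, h5⟩ := h
  refine ⟨h1, h2, h3, h4, h5.imp_left ?_⟩
  rintro ⟨h6, h7, h8⟩
  exact ⟨h6, h7, Nat.forall_lt_succ_right.2 ⟨h8, by rwa [h7] at hj⟩⟩

theorem Swept.mark {T B j : ℕ} {s s' s'' : State} (h : Swept G L T B s j s') (hk : 0 < k)
    (hjB : j < B) (hj : Fires G L (fun ρ => s'.mem (T + ρ)) j) (hj0 : s'.mem (T + j) = 0)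
    (hs : Keep 10 s' s'') (h10 : s''.reg 10 = 1)
    (hm : s''.mem = Function.update s'.mem (T + j) 1) : Swept G L T B s (j + 1) s'' := by
  obtain ⟨h1, h2, h3, h4, h5⟩ := h
  refine ⟨h1.trans hs le_rfl, fun a ha => ?_, ?_, fun a ha => ?_, Or.inr ⟨by omega, j, hjB, ?_, ?_⟩⟩
  · rw [hm, Function.update_of_ne (by omega), h2 a ha]
  · convert h3.update hk hj 1 using 1
    funext ρ
    simp [hm, Function.update_apply]
  · rw [hm, Function.update_apply]
    split_ifs
    · decide
    · exact h4 a ha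
  · by_contra hne
    exact h4 _ hne hj0
  · simp [hm]

theorem runs_sweepProg {T B : ℕ} {s : State} (hs : Ready n k T s) (hB : s.reg 7 = B)
    (h10 : s.reg 10 = 0) (hM : Encodes G L s.mem) (hk : 0 < k) (hT : 1 + n * n + n * k ≤ T)
    (hF : SoundTable G L fun ρ => s.mem (T + ρ)) :
    Runs sweepProg s (B * (bodyCost n k B + 4) + 4) (Swept G L T B s B) := by
  refine runs_forLoop (fun j => Swept G L T B s j) (by decide) (by decide) (by decide) hB ?_ ?_
    fun _ h => h
  · refine Swept.of_regs (s' := s) ⟨Keep.refl _ _, fun _ _ => rfl, hF, fun _ h => h,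
      Or.inl ⟨h10, rfl, by simp⟩⟩ (((Keep.refl _ _).setReg (by decide) _).setReg (by decide) _) rfl
  · intro j hj s' hI hi hl
    have hr := hs.keep hI.keep le_rfl
    refine runs_bodyProg hr hi
      (hM.congr fun a ha => hI.outside a (by omega)) hk ?_ ?_ (by unfold bodyCost; omega)
    · intro hstay s'' hk'' hm''
      refine ⟨by rw [hk'' 11 (by decide), hi], by rw [hk'' 7 (by decide), hl],
        by rw [hk'' 1 (by decide), hr.one], fun x => ?_⟩
      exact ((hI.stay hstay).of_regs (s'' := s'') (fun i h => hk'' i (by omega)) hm'').of_regs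
        (((Keep.refl _ _).setReg (by decide) _).setReg (by decide) _) rfl
    · intro hf h0 s'' hk'' hm''
      have e : ∀ i, i < 13 → s''.reg i = if i = 10 then 1 else s'.reg i := fun i h => by
        rw [hk'' i (Or.inl h), State.setReg_reg]
      refine ⟨by rw [e 11 (by decide)]; exact hi, by rw [e 7 (by decide)]; exact hl,
        by rw [e 1 (by decide)]; exact hr.one, fun x => ?_⟩
      refine (hI.mark hk hj hf h0 (fun i h => ?_) (e 10 (by decide)) hm'').of_regs
        (((Keep.refl _ _).setReg (by decide) _).setReg (by decide) _) rfl
      rw [hk'' i (by omega), State.setReg_reg, if_neg (by omega)]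

/-- Apply the rules until no mark is added. -/
def closeProg : Prog := .loop 10 (.seq (straight [.const 10 0]) sweepProg)

/-- The unmarked numbers below `B`. -/
def unmarked (T B : ℕ) (M : ℕ → ℕ) : Finset ℕ := {σ ∈ Finset.range B | M (T + σ) = 0}

/-- Every sweep that sets the flag reduces the number of unmarked cells. A sweep that leaves it at 0
has not changed the memory, so all its tests refer to the final table, which is therefore closed. -/
theorem runs_closeProg {T B : ℕ} (hk : 0 < k) (hT : 1 + n * n + n * k ≤ T) (m : ℕ) :
    ∀ s : State, (unmarked T B s.mem).card = m → Ready n k T s → s.reg 7 = B → s.reg 10 ≠ 0 →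
      Encodes G L s.mem → (SoundTable G L fun ρ => s.mem (T + ρ)) →
      Runs closeProg s ((m + 1) * (B * (bodyCost n k B + 4) + 7) + 1) fun s' =>
        Keep 10 s s' ∧ (∀ a, a < T ∨ T + B ≤ a → s'.mem a = s.mem a) ∧
        (SoundTable G L fun ρ => s'.mem (T + ρ)) ∧
        ClosedTable G L B fun ρ => s'.mem (T + ρ) := by
  induction m using Nat.strong_induction_on with
  | _ m ih =>
    intro s hm hs hB h10 hM hF
    set S := B * (bodyCost n k B + 4) + 7
    refine (Runs.loop_true (T := S - 1) (T' := m * S + 1) h10 ?_).mono ?_ fun _ h => h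
    · refine (Runs.seq (T := 2) (T' := B * (bodyCost n k B + 4) + 4) (runs_straight ?_ (by simp))).mono
        (by omega) fun _ h => h
      simp only [runList, Instr.run]
      have hk₀ : Keep 10 s (s.setReg 10 0) := (Keep.refl _ _).setReg (by decide) _
      refine (runs_sweepProg (hs.keep hk₀ le_rfl) (by simpa using hB) (by simp)
        hM hk hT hF).mono le_rfl fun s' h => ?_
      have hks := hk₀.trans h.keep le_rfl
      rcases h.progress with ⟨h1, h2, h3⟩ | ⟨h1, σ, h2, h3, h4⟩
      · exact Runs.loop_false h1 ⟨hks, h.outside, h.sound, by rw [h2]; exact h3⟩ (by omega)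
      · have hlt : (unmarked T B s'.mem).card < m := by
          rw [← hm]
          refine Finset.card_lt_card ⟨fun ρ hρ => ?_, fun hsub => ?_⟩
          · simp only [unmarked, Finset.mem_filter] at hρ ⊢
            refine ⟨hρ.1, ?_⟩
            by_contra hne
            exact h.marked _ hne hρ.2
          · have := hsub (Finset.mem_filter.2 ⟨Finset.mem_range.2 h2, h3⟩)
            exact h4 (Finset.mem_filter.1 this).2
        refine (ih _ hlt s' rfl (hs.keep hks le_rfl) (by rw [hks 7 (by decide), hB]) h1
          (hM.congr fun a ha => h.outside a (by omega)) h.sound).mono ?_ ?_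
        · exact Nat.add_le_add_right (Nat.mul_le_mul_right _ hlt) _
        · rintro s'' ⟨h5, h6, h7, h8⟩
          exact ⟨hks.trans h5 le_rfl, fun a ha => (h6 a ha).trans (h.outside a ha), h7, h8⟩
    · rw [Nat.add_mul, one_mul]; omega

/-- Decide with the help of an empty table whether there is a list coloring; `reg 32` is `0` if
there is one. -/
def solveProg : Prog :=
  .seq (straight [.const 10 1]) (.seq closeProg (.seq (straight [.const 23 0]) checkProg))

/-- The time of `solveProg` with a table of length `B`. -/
def solveCost (n k B : ℕ) : ℕ :=
  (B + 1) * (B * (bodyCost n k B + 4) + 7) + n * (k * 10 + 13) + 13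

/-- An empty table is sound, and sweeping keeps it sound. After closing, testing the number 0
decides the instance; at most `B` cells can be marked, which bounds the number of sweeps by B + 1.
-/
theorem runs_solveProg {T B r t : ℕ} {s : State} {Q : State → Prop} (hs : Ready n k T s)
    (hB : s.reg 7 = B) (hM : Encodes G L s.mem) (hk : 0 < k) (hT : 1 + n * n + n * k ≤ T)
    (hzero : ∀ a, T ≤ a → s.mem a = 0) (hBr : ((n + 1) * k) ^ (r + 1) ≤ B)
    (hr : (¬ ∃ f, IsListColoring G L f) → Refutable G r L)
    (hQ : ∀ s', Keep 10 s s' → (∀ a, a < T ∨ T + B ≤ a → s'.mem a = s.mem a) →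
      (s'.reg 32 ≠ 0 ↔ ¬ ∃ f, IsListColoring G L f) → Q s') (ht : solveCost n k B ≤ t) :
    Runs solveProg s t Q := by
  set S := B * (bodyCost n k B + 4) + 7 with hS
  refine (Runs.seq (T := 2) (T' := ((B + 1) * S + 1) + (2 + (n * (k * 10 + 13) + 8)))
    (runs_straight ?_ (by simp))).mono (by unfold solveCost at ht; rw [← hS] at ht; omega) fun _ h => h
  simp only [runList, Instr.run]
  have hk₀ : Keep 10 s (s.setReg 10 1) := (Keep.refl _ _).setReg (by decide) _
  refine Runs.seq ((runs_closeProg hk hT _ _ rfl (hs.keep hk₀ le_rfl) (by simpa using hB) (by simp)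
    hM ?_).mono ?_ ?_)
  · convert soundTable_zero using 1
    funext ρ
    exact hzero _ (by omega)
  · refine Nat.add_le_add_right (Nat.mul_le_mul_right _ (Nat.add_le_add_right ?_ _)) _
    exact (Finset.card_filter_le _ _).trans (by simp)
  rintro s₁ ⟨h1, h2, h3, h4⟩
  have hk₁ := hk₀.trans h1 le_rfl
  refine Runs.seq (T := 2) (runs_straight ?_ (by simp))
  simp only [runList, Instr.run]
  have hk₂ : Keep 10 s (s₁.setReg 23 0) := hk₁.setReg (by decide) _
  have hr₂ := hs.keep hk₂ le_rfl
  refine runs_checkProg hr₂.one ?_ (by rw [hr₂.card, hr₂.colors])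
  rw [hr₂.card, hr₂.colors, hr₂.table]
  intro s₃ hk₃ hm₃ hf
  refine hQ s₃ (hk₂.trans hk₃ (by decide)) (by rw [hm₃]; exact h2) (hf.trans ?_)
  rw [← refuted_zero_iff h4 h3 hBr hr, refuted_iff]
  simp [add_assoc]

end ListColoring

/-! ### Constructing a coloring by self-reduction -/

namespace ListColoring

open RAM

variable {n k : ℕ} {G : SimpleGraph (Fin n)} {L : Fin n → Finset (Fin k)}

theorem Encodes.congr_ne_zero {M M' : ℕ → ℕ} (h : Encodes G L M)
    (hM : ∀ a < 1 + n * n + n * k, (M' a ≠ 0 ↔ M a ≠ 0)) : Encodes G L M' := by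
  have h' : Encodes G L fun a => if a < 1 + n * n + n * k then M a else M' a :=
    h.congr fun a ha => if_pos ha
  have key : ∀ a, (M' a ≠ 0 ↔ (if a < 1 + n * n + n * k then M a else M' a) ≠ 0) := fun a => by
    split_ifs with ha
    · exact hM a ha
    · rfl
  exact ⟨fun u v => (key _).trans (h'.1 u v), fun v c => (key _).trans (h'.2 v c)⟩

theorem index_inj {v v' c c' : ℕ} (hc : c < k) (hc' : c' < k) (h : k * v + c = k * v' + c') :
    v = v' ∧ c = c' := by
  have h1 : (k * v + c) / k = v := by
    rw [Nat.mul_add_div (by omega), Nat.div_eq_of_lt hc, add_zero]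
  have h2 : (k * v' + c') / k = v' := by
    rw [Nat.mul_add_div (by omega), Nat.div_eq_of_lt hc', add_zero]
  have hv : v = v' := by rw [← h1, h, h2]
  subst hv
  exact ⟨rfl, by omega⟩

theorem index_lt (v : Fin n) (c : Fin k) : k * v + c < n * k := by
  have h1 : k * (v + 1) ≤ k * n := Nat.mul_le_mul_left _ v.2
  have h2 := c.2
  rw [Nat.mul_add, mul_comm k n] at h1
  omega

theorem exists_eq_index {j : ℕ} (hj : j < n * k) :
    ∃ (v : Fin n) (c : Fin k), j = k * v + c := by
  have hk : 0 < k := Nat.pos_of_mul_pos_left ((Nat.zero_le _).trans_lt hj)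
  exact ⟨⟨j / k, Nat.div_lt_of_lt_mul (by rwa [mul_comm] at hj)⟩, ⟨j % k, Nat.mod_lt _ hk⟩,
    (Nat.div_add_mod j k).symm⟩

theorem Encodes.remove {M : ℕ → ℕ} (h : Encodes G L M) (v : Fin n) (c : Fin k) :
    Encodes G (remove L v c) (Function.update M (1 + n * n + (k * v + c)) 0) := by
  constructor
  · intro u w
    have h1 : n * (u + 1) ≤ n * n := Nat.mul_le_mul_left _ u.2
    have h2 := w.2
    rw [Nat.mul_add] at h1
    rw [Function.update_of_ne (by omega), h.1]
  · intro w d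
    rw [Function.update_apply, mem_remove]
    split_ifs with hwd
    · obtain ⟨h1, h2⟩ := index_inj d.2 c.2 (show k * (w : ℕ) + d = k * v + c by omega)
      simp [Fin.ext_iff, h1, h2]
    · rw [h.2, iff_self_and]
      rintro - rfl rfl
      exact hwd (by ring)

/-- All colors of `L` with index below `j` are needed for a list coloring. -/
def Critical (G : SimpleGraph (Fin n)) (L : Fin n → Finset (Fin k)) (j : ℕ) : Prop :=
  ∀ (v : Fin n) (c : Fin k), k * v + c < j → c ∈ L v → ¬ ∃ f, IsListColoring G (remove L v c) f

/-- If some list contained a second color, `f` would survive its removal. Hence critical lists are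
singletons and spell out the coloring. -/
theorem Critical.eq_of_mem {L : Fin n → Finset (Fin k)} (h : Critical G L (n * k))
    {f : Fin n → Fin k} (hf : IsListColoring G L f) (v : Fin n) (c : Fin k) :
    c ∈ L v ↔ c = f v := by
  refine ⟨fun hc => ?_, fun hc => hc ▸ hf.2 v⟩
  by_contra hne
  refine h v c (index_lt v c) hc ⟨f, hf.1, fun u => mem_remove.2 ⟨hf.2 u, ?_⟩⟩
  rintro rfl he
  exact hne he.symm

/-- Shrinking the lists cannot make a needed color dispensable, and the deleted entry itself no
longer counts. -/
theorem Critical.remove {j : ℕ} (h : Critical G L j) {v : Fin n} {c : Fin k}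
    (hj : j = k * v + c) : Critical G (remove L v c) (j + 1) := by
  rintro w d hwd hd ⟨f, hf⟩
  rw [mem_remove] at hd
  rcases Nat.lt_succ_iff_lt_or_eq.1 hwd with hlt | heq
  · refine h w d hlt hd.1 ⟨f, hf.1, fun u => ?_⟩
    have := hf.2 u
    rw [mem_remove, mem_remove] at this
    exact mem_remove.2 ⟨this.1.1, this.2⟩
  · obtain ⟨h1, h2⟩ := index_inj d.2 c.2 (heq.trans hj)
    exact hd.2 (Fin.ext h1) (Fin.ext h2)

theorem Critical.succ {j : ℕ} (h : Critical G L j) {v : Fin n} {c : Fin k}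
    (hj : j = k * v + c) (hc : c ∈ L v → ¬ ∃ f, IsListColoring G (ListColoring.remove L v c) f) :
    Critical G L (j + 1) := by
  intro w d hwd hd
  rcases Nat.lt_succ_iff_lt_or_eq.1 hwd with hlt | heq
  · exact h w d hlt hd
  · obtain ⟨h1, h2⟩ := index_inj d.2 c.2 (heq.trans hj)
    obtain rfl := Fin.ext h1
    obtain rfl := Fin.ext h2
    exact hc hd

theorem Ready.of_regs {T : ℕ} {s s' : State} (h : Ready n k T s)
    (hs : ∀ i < 10, s'.reg i = s.reg i) : Ready n k T s' := by
  obtain ⟨h0, h1, h2, h3, h4, h5, h9⟩ := h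
  constructor <;> rw [hs _ (by decide)] <;> assumption

/-- Delete list entries as long as there is a list coloring. -/
def reduceProg : Prog :=
  forLoop 40 6 41 (.seq (straight [.add 42 5 40, .load 43 42])
    -- Every test uses a fresh table, `B` cells further on, where the memory is still zero; the old
    -- table is not erased.
    (.ite 43 (.seq (straight [.store 42 0, .add 9 9 7])
      (.seq solveProg (.ite 32 (straight [.store 42 1]) .skip))) .skip))

/-- What `reduceProg` has achieved before it comes to the list entry with index `j`. -/
structure Reduced (G : SimpleGraph (Fin n)) (L : Fin n → Finset (Fin k)) (B j : ℕ) (s : State) :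
    Prop where
  exists_state : ∃ (T : ℕ) (L' : Fin n → Finset (Fin k)), Ready n k T s ∧
    1 + n * n + n * k ≤ T ∧ Encodes G L' s.mem ∧ (∀ v, L' v ⊆ L v) ∧
    (∃ f, IsListColoring G L' f) ∧ Critical G L' j ∧ ∀ a, T + B ≤ a → s.mem a = 0
  size : s.reg 6 = n * k
  length : s.reg 7 = B

theorem Reduced.of_regs {B j : ℕ} {s s' : State} (h : Reduced G L B j s)
    (hs : ∀ i < 10, s'.reg i = s.reg i) (hm : s'.mem = s.mem) : Reduced G L B j s' := by
  obtain ⟨⟨T, L', h1, h2⟩, h3, h4⟩ := h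
  exact ⟨⟨T, L', h1.of_regs hs, by rwa [hm]⟩, by rw [hs 6 (by decide), h3],
    by rw [hs 7 (by decide), h4]⟩

theorem runs_reduceProg {B r : ℕ} {s : State} (hk : 0 < k)
    (hBr : ((n + 1) * k) ^ (r + 1) ≤ B)
    (hr : ∀ L' : Fin n → Finset (Fin k), (¬ ∃ f, IsListColoring G L' f) → Refutable G r L')
    (hs : Reduced G L B 0 s) :
    Runs reduceProg s (n * k * (solveCost n k B + 14) + 4) (Reduced G L B (n * k)) := by
  refine (runs_forLoop (T := solveCost n k B + 10) (fun j => Reduced G L B j) (by decide)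
    (by decide) (by decide) hs.size ?_ ?_ fun _ h => h)
  · refine hs.of_regs (fun i hi => ?_) rfl
    simp only [State.setReg_reg]
    rw [if_neg (by omega), if_neg (by omega)]
  · rintro j hj s₀ ⟨⟨T, L', hr₀, hT, hM, hL', hsat, hcrit, hzero⟩, hN, hB⟩ h40 -
    obtain ⟨v, c, hvc⟩ := exists_eq_index hj
    refine (Runs.seq (T := 3) (T' := 3 + (solveCost n k B + 3) + 1) (runs_straight ?_ (by simp))).mono
      (by omega) fun _ h => h
    simp only [runList, Instr.run]
    set s₁ := (s₀.setReg 42 (s₀.reg 5 + s₀.reg 40)).setReg 43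
      ((s₀.setReg 42 (s₀.reg 5 + s₀.reg 40)).mem
        ((s₀.setReg 42 (s₀.reg 5 + s₀.reg 40)).reg 42)) with hs₁
    have e₁ : ∀ i, i < 42 → s₁.reg i = s₀.reg i := fun i hi => by
      simp only [hs₁, State.setReg_reg]
      rw [if_neg (by omega), if_neg (by omega)]
    have e42 : s₁.reg 42 = 1 + n * n + (k * v + c) := by simp [hs₁, hr₀.lists, h40, hvc]
    have e43 : s₁.reg 43 = s₀.mem (1 + n * n + (k * v + c)) := by
      simp [hs₁, hr₀.lists, h40, hvc]
    have m₁ : s₁.mem = s₀.mem := rfl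
    clear_value s₁
    have hcell : s₀.mem (1 + n * n + (k * v + c)) ≠ 0 ↔ c ∈ L' v := by
      rw [← add_assoc]; exact hM.2 v c
    refine Runs.ite (fun h43 => ?_) (fun h43 => ?_)
    swap
    · refine Runs.skip ⟨by rw [e₁ 40 (by decide), h40], by rw [e₁ 6 (by decide), hN],
        by rw [e₁ 1 (by decide), hr₀.one], fun x => ?_⟩ (by omega)
      refine Reduced.of_regs (s := s₀) ⟨⟨T, L', hr₀, hT, hM, hL', hsat, hcrit.succ hvc ?_, hzero⟩,
        hN, hB⟩ (fun i hi => ?_) m₁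
      · intro hc
        exact absurd (e43.symm.trans h43) (hcell.2 hc)
      · simp only [State.setReg_reg]
        rw [if_neg (by omega), if_neg (by omega), e₁ i (by omega)]
    refine Runs.seq (T := 3) (runs_straight ?_ (by simp))
    have hc : c ∈ L' v := hcell.1 (by rwa [← e43])
    have hNlt : k * (v : ℕ) + c < n * k := index_lt v c
    set s₂ := runList [.store 42 0, .add 9 9 7] s₁ with hs₂
    have m₂ : s₂.mem = Function.update s₀.mem (1 + n * n + (k * v + c)) 0 := by
      simp [hs₂, runList, Instr.run, e42, m₁, e₁, hr₀.zero]
    have e₂ : ∀ i, i ≠ 9 → s₂.reg i = s₁.reg i := fun i hi => by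
      simp [hs₂, runList, Instr.run, hi]
    have e9 : s₂.reg 9 = T + B := by
      simp [hs₂, runList, Instr.run, e₁, hr₀.table, hB]
    clear_value s₂
    have hr₂ : Ready n k (T + B) s₂ := by
      obtain ⟨f0, f1, f2, f3, f4, f5, f9⟩ := hr₀
      constructor <;> first | exact e9 | (rw [e₂ _ (by decide), e₁ _ (by decide)]; assumption)
    have hM₂ : Encodes G (remove L' v c) s₂.mem := by rw [m₂]; exact hM.remove v c
    have hz₂ : ∀ a, T + B ≤ a → s₂.mem a = 0 := fun a ha => by
      rw [m₂, Function.update_of_ne (by omega), hzero a ha]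
    have g40 : s₂.reg 40 = j := by rw [e₂ _ (by decide), e₁ _ (by decide), h40]
    have g42 : s₂.reg 42 = 1 + n * n + (k * v + c) := by rw [e₂ _ (by decide), e42]
    have g6 : s₂.reg 6 = n * k := by rw [e₂ _ (by decide), e₁ _ (by decide), hN]
    have g7 : s₂.reg 7 = B := by rw [e₂ _ (by decide), e₁ _ (by decide), hB]
    refine Runs.seq (runs_solveProg hr₂ g7 hM₂ hk (by omega) hz₂ hBr (hr _) ?_ le_rfl)
    intro s₃ hk₃ hm₃ hflag
    have hr₃ := hr₂.keep hk₃ le_rfl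
    have i40 : s₃.reg 40 = j := by rw [hk₃ 40 (by decide), g40]
    have i42 : s₃.reg 42 = 1 + n * n + (k * v + c) := by rw [hk₃ 42 (by decide), g42]
    have i6 : s₃.reg 6 = n * k := by rw [hk₃ 6 (by decide), g6]
    have i7 : s₃.reg 7 = B := by rw [hk₃ 7 (by decide), g7]
    refine Runs.ite (T := 2) (fun h32 => runs_straight ?_ (by simp))
      (fun h32 => Runs.skip ?_ (by decide))
    · simp only [runList, Instr.run]
      refine ⟨i40, i6, hr₃.one, fun x => ?_⟩
      refine Reduced.of_regs (s := s₃.setMem (s₃.reg 42) (s₃.reg 1)) ⟨⟨T + B, L', ?_, by omega, ?_,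
        hL', hsat, hcrit.succ hvc fun _ => hflag.1 h32, fun a ha => ?_⟩, i6, i7⟩
        (fun i hi => ?_) rfl
      · obtain ⟨f0, f1, f2, f3, f4, f5, f9⟩ := hr₃
        exact ⟨f0, f1, f2, f3, f4, f5, f9⟩
      -- The entry is restored as 1, whatever nonzero value it had. Only being nonzero matters for
      -- the encoding.
      · refine hM.congr_ne_zero fun a ha => ?_
        rw [State.setMem_mem, i42, hr₃.one, Function.update_apply]
        split_ifs with hav
        · rw [hav, hcell]; simp [hc]
        · rw [hm₃ a (by omega), m₂, Function.update_of_ne hav]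
      · rw [State.setMem_mem, i42, Function.update_of_ne (by omega), hm₃ a (by omega),
          hz₂ a (by omega)]
      · simp only [State.setReg_reg]
        rw [if_neg (by omega), if_neg (by omega)]
    · refine ⟨i40, i6, hr₃.one, fun x => ?_⟩
      refine Reduced.of_regs (s := s₃) ⟨⟨T + B, remove L' v c, hr₃, by omega,
        hM₂.congr fun a ha => hm₃ a (by omega), fun u => (remove_subset _ _ _ _).trans (hL' u),
        ?_, hcrit.remove hvc, fun a ha => ?_⟩, i6, i7⟩ (fun i hi => ?_) rfl
      · by_contra hno
        exact hflag.2 hno h32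
      · rw [hm₃ a (by omega), hz₂ a (by omega)]
      · simp only [State.setReg_reg]
        rw [if_neg (by omega), if_neg (by omega)]

/-- Write the colors of the vertices into the cells `1, ..., n`. -/
def outputProg : Prog :=
  forLoop 40 6 41 (.seq (divMod 13 14 15 40 3) (.seq (straight [.add 42 5 40, .load 43 42])
    (.ite 43 (straight [.add 16 13 1, .store 16 14]) .skip)))

theorem runs_outputProg {s : State} {T : ℕ} {f : Fin n → Fin k} (hs : Ready n k T s)
    (h6 : s.reg 6 = n * k)
    (hf : ∀ (v : Fin n) (c : Fin k), s.mem (1 + n * n + (k * v + c)) ≠ 0 ↔ c = f v) :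
    Runs outputProg s (n * k * (6 * (n * k) + 20) + 4) fun s' =>
      Ready n k T s' ∧ ∀ v : Fin n, s'.mem (1 + v) = f v := by
  refine (runs_forLoop (T := 6 * (n * k) + 16) (fun j s' => (∀ i < 10, s'.reg i = s.reg i) ∧
    (∀ a, 1 + n * n ≤ a → s'.mem a = s.mem a) ∧
    ∀ v : Fin n, k * v + f v < j → s'.mem (1 + v) = f v)
    (by decide) (by decide) (by decide) h6 ?_ ?_ ?_)
  · refine ⟨fun i hi => ?_, fun _ _ => rfl, fun v hv => absurd hv (by omega)⟩
    simp only [State.setReg_reg]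
    rw [if_neg (by omega), if_neg (by omega)]
  · rintro j hj s₀ ⟨hreg, hmem, hout⟩ h40 -
    obtain ⟨v, c, hvc⟩ := exists_eq_index hj
    have hk : 0 < k := c.pos
    have hr₀ := hs.of_regs hreg
    refine (Runs.seq (T := 6 * j + 6) (T' := 3 + (3 + 1)) ?_).mono (by omega) fun _ h => h
    refine runs_divMod (by decide) (by decide) (by decide) hr₀.zero hr₀.one
      (by rw [hr₀.colors]; exact hk) ?_ (by rw [h40])
    refine Runs.seq (runs_straight ?_ (by simp))
    have hdiv : j / k = v := by
      rw [hvc, Nat.mul_add_div hk, Nat.div_eq_of_lt c.2, add_zero]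
    have hmod : j % k = c := by rw [hvc, Nat.mul_add_mod, Nat.mod_eq_of_lt c.2]
    rw [h40, hr₀.colors, hdiv, hmod]
    set s₁ := runList [.add 42 5 40, .load 43 42]
      (((s₀.setReg 13 v).setReg 14 c).setReg 15 0) with hs₁
    have e₁ : ∀ i < 10, s₁.reg i = s₀.reg i := fun i hi => by
      simp only [hs₁, runList, Instr.run, State.setReg_reg]
      repeat' rw [if_neg (by omega)]
    have e13 : s₁.reg 13 = v := by simp [hs₁, runList, Instr.run]
    have e14 : s₁.reg 14 = c := by simp [hs₁, runList, Instr.run]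
    have e40 : s₁.reg 40 = j := by simp [hs₁, runList, Instr.run, h40]
    have e43 : s₁.reg 43 = s.mem (1 + n * n + (k * v + c)) := by
      rw [← hmem _ (by omega)]
      simp [hs₁, runList, Instr.run, h40, hvc, hr₀.lists]
    have m₁ : s₁.mem = s₀.mem := rfl
    clear_value s₁
    have hr₁ := hr₀.of_regs e₁
    have e6 : s₁.reg 6 = n * k := by rw [e₁ 6 (by decide), hreg 6 (by decide), h6]
    refine Runs.ite (fun h43 => runs_straight ?_ (by simp)) fun h43 => Runs.skip ?_ (by decide)
    · have hcv : c = f v := (hf v c).1 (by rwa [← e43])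
      set s₂ := runList [.add 16 13 1, .store 16 14] s₁ with hs₂
      have e₂ : ∀ i, i ≠ 16 → s₂.reg i = s₁.reg i := fun i hi => by
        simp [hs₂, runList, Instr.run, hi]
      have m₂ : s₂.mem = Function.update s₀.mem (1 + v) c := by
        simp [hs₂, runList, Instr.run, e13, e14, hr₁.one, m₁, add_comm]
      clear_value s₂
      refine ⟨by rw [e₂ _ (by decide), e40], by rw [e₂ _ (by decide), e6],
        by rw [e₂ _ (by decide), hr₁.one], fun x => ⟨fun i hi => ?_, fun a ha => ?_,
          fun w hw => ?_⟩⟩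
      · simp only [State.setReg_reg]
        rw [if_neg (by omega), if_neg (by omega), e₂ _ (by omega), e₁ i hi, hreg i hi]
      -- The output overwrites part of the adjacency matrix but stays below the lists, which are
      -- still being read.
      · have hvn : (v : ℕ) < n * n := v.2.trans_le (Nat.le_mul_self n)
        rw [State.setReg_mem, State.setReg_mem, m₂, Function.update_of_ne (by omega), hmem a ha]
      · rw [State.setReg_mem, State.setReg_mem, m₂, Function.update_apply]
        split_ifs with hwv
        · have : w = v := Fin.ext (by omega)
          rw [this, hcv]
        · refine hout w (lt_of_le_of_ne (Nat.lt_succ_iff.1 hw) fun heq => hwv ?_)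
          rw [(index_inj (f w).2 c.2 (heq.trans hvc)).1]
    · refine ⟨e40, e6, hr₁.one, fun x => ⟨fun i hi => ?_, fun a ha => ?_, fun w hw => ?_⟩⟩
      · simp only [State.setReg_reg]
        rw [if_neg (by omega), if_neg (by omega), e₁ i hi, hreg i hi]
      · rw [State.setReg_mem, State.setReg_mem, m₁, hmem a ha]
      · rw [State.setReg_mem, State.setReg_mem, m₁]
        refine hout w (lt_of_le_of_ne (Nat.lt_succ_iff.1 hw) fun heq => ?_)
        obtain ⟨h1, h2⟩ := index_inj (f w).2 c.2 (heq.trans hvc)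
        have hcv : c = f v := by
          rw [← Fin.ext h1]
          exact (Fin.ext h2).symm
        exact (hf v c).2 hcv (e43.symm.trans h43)
  · rintro s' ⟨h1, -, h2⟩
    exact ⟨hs.of_regs h1, fun v => h2 v (index_lt v (f v))⟩

/-- Decide, then construct a list coloring and write the answer into the memory. -/
def answerProg : Prog :=
  .seq solveProg (.ite 32 (straight [.store 0 0])
    (.seq reduceProg (.seq outputProg (straight [.store 0 1]))))

/-- The time of `answerProg`. -/
def answerCost (n k B : ℕ) : ℕ :=
  solveCost n k B + n * k * (solveCost n k B + 14) + n * k * (6 * (n * k) + 20) + 11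

/-- The depth has to work for all lists `L'`, because the self-reduction solves instances with
smaller lists on the same graph. -/
theorem runs_answerProg {B r : ℕ} {s : State} (hk : 0 < k)
    (hBr : ((n + 1) * k) ^ (r + 1) ≤ B)
    (hr : ∀ L' : Fin n → Finset (Fin k), (¬ ∃ f, IsListColoring G L' f) → Refutable G r L')
    (hs : Ready n k (1 + n * n + n * k) s) (h6 : s.reg 6 = n * k) (h7 : s.reg 7 = B)
    (hM : Encodes G L s.mem) (hzero : ∀ a, 1 + n * n + n * k ≤ a → s.mem a = 0) :
    Runs answerProg s (answerCost n k B) (IsCorrectOutput G L) := by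
  refine (Runs.seq (T := solveCost n k B) (T' := (n * k * (solveCost n k B + 14) + 4 +
    (n * k * (6 * (n * k) + 20) + 4 + 2)) + 1) ?_).mono (by unfold answerCost; omega) fun _ h => h
  refine runs_solveProg hs h7 hM hk le_rfl hzero hBr (hr L) ?_ le_rfl
  intro s₁ hk₁ hm₁ hflag
  have hr₁ := hs.keep hk₁ le_rfl
  refine Runs.ite (fun h32 => runs_straight ?_ (by simp; omega)) fun h32 => ?_
  · refine Or.inr ⟨hflag.1 h32, ?_⟩
    simp [runList, Instr.run, hr₁.zero]
  have hsat : ∃ f, IsListColoring G L f := by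
    by_contra hno
    exact hflag.2 hno h32
  refine Runs.seq ((runs_reduceProg hk hBr hr (L := L) (s := s₁) ⟨⟨_, L, hr₁, le_rfl,
    hM.congr fun a ha => hm₁ a (by omega), fun _ => Finset.Subset.refl _, hsat,
    fun v c h => absurd h (by omega), fun a ha => ?_⟩, ?_, ?_⟩).mono le_rfl ?_)
  · rw [hm₁ a (by omega), hzero a (by omega)]
  · rw [hk₁ 6 (by decide), h6]
  · rw [hk₁ 7 (by decide), h7]
  rintro s₂ ⟨⟨T, L', hr₂, hT, hM₂, hL', ⟨f, hf⟩, hcrit, -⟩, h6₂, -⟩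
  refine Runs.seq ((runs_outputProg (f := f) hr₂ h6₂ fun v c => ?_).mono le_rfl ?_)
  · rw [← add_assoc, hM₂.2, hcrit.eq_of_mem hf]
  rintro s₃ ⟨hr₃, hout⟩
  refine runs_straight (Or.inl ⟨f, ⟨hf.1, fun v => hL' v (hf.2 v)⟩, ?_, fun v => ?_⟩) (by simp)
  · simp [runList, Instr.run, hr₃.zero, hr₃.one]
  · rw [← hout v]
    simp only [runList, Instr.run, hr₃.zero, State.setMem_mem]
    rw [Function.update_of_ne (by omega)]

end ListColoring

/-! ### Initialization and the length of the table -/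

namespace ListColoring

open RAM

variable {n k : ℕ}

theorem encodes_inputMem (G : SimpleGraph (Fin n)) (L : Fin n → Finset (Fin k)) :
    Encodes G L (inputMem G L) := by
  have h1 : ∀ u v : Fin n, n * (u : ℕ) + v < n * n := fun u v => index_lt u v
  constructor
  · intro u v
    rw [inputMem, if_neg (by omega)]
    simp only [ne_eq, ite_eq_right_iff, one_ne_zero, imp_false, not_not]
    constructor
    · rintro (⟨u', v', h, huv⟩ | ⟨v', c, h, -⟩)
      · obtain ⟨h2, h3⟩ := index_inj v.2 v'.2 (show n * (u : ℕ) + v = n * u' + v' by omega)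
        rwa [Fin.ext h2, Fin.ext h3]
      · have := h1 u v
        omega
    · exact fun h => Or.inl ⟨u, v, rfl, h⟩
  · intro v c
    rw [inputMem, if_neg (by omega)]
    simp only [ne_eq, ite_eq_right_iff, one_ne_zero, imp_false, not_not]
    constructor
    · rintro (⟨u', v', h, -⟩ | ⟨v', c', h, hvc⟩)
      · have := h1 u' v'
        omega
      · obtain ⟨h2, h3⟩ := index_inj c.2 c'.2 (show k * (v : ℕ) + c = k * v' + c' by omega)
        rwa [Fin.ext h2, Fin.ext h3]
    · exact fun h => Or.inr ⟨v, c, rfl, h⟩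

theorem inputMem_eq_zero (G : SimpleGraph (Fin n)) (L : Fin n → Finset (Fin k)) (a : ℕ)
    (ha : 1 + n * n + n * k ≤ a) : inputMem G L a = 0 := by
  rw [inputMem, if_neg (by omega), if_neg]
  rintro (⟨u, v, h, -⟩ | ⟨v, c, h, -⟩)
  · have : n * (u : ℕ) + v < n * n := index_lt u v
    omega
  · have := index_lt v c
    omega

variable (k) in
/-- Fill the registers with the constants of the instance. -/
def initProg : Prog :=
  .seq (straight [.const 1 1, .load 2 0, .const 3 k, .add 29 2 1]) (.seq (mul 4 29 3 28)
    (.seq (mul 5 2 2 28) (.seq (straight [.add 5 5 1]) (.seq (mul 6 2 3 28)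
      (straight [.add 9 5 6])))))

theorem runs_initProg (G : SimpleGraph (Fin n)) (L : Fin n → Finset (Fin k)) :
    Runs (initProg k) (input G L) (8 * k + 4 * n + 21) fun s =>
      Ready n k (1 + n * n + n * k) s ∧ s.reg 6 = n * k ∧ s.mem = inputMem G L := by
  refine (Runs.seq (T := 5) (T' := 4 * k + 4 + (4 * n + 4 + (2 + (4 * k + 4 + 2))))
    (runs_straight ?_ (by simp))).mono (by omega) fun _ h => h
  have hn : inputMem G L 0 = n := by simp [inputMem]
  refine Runs.seq (runs_mul (by decide) (by decide) (by simp [runList, Instr.run, input])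
    (by simp [runList, Instr.run, input]) ?_ (by simp [runList, Instr.run, input]))
  refine Runs.seq (runs_mul (by decide) (by decide) (by simp [runList, Instr.run, input])
    (by simp [runList, Instr.run, input]) ?_ (by simp [runList, Instr.run, input, hn]))
  refine Runs.seq (runs_straight ?_ (by simp))
  refine Runs.seq (runs_mul (by decide) (by decide) (by simp [runList, Instr.run, input])
    (by simp [runList, Instr.run, input]) ?_ (by simp [runList, Instr.run, input]))
  refine runs_straight ?_ (by simp)
  refine ⟨?_, ?_, rfl⟩
  · constructor <;> simp [runList, Instr.run, input, hn, add_comm]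
  · simp [runList, Instr.run, input, hn]

variable (n k) in
/-- The depth `r` of the search is sufficient for graphs with `n` vertices. -/
def IsDepth (r : ℕ) : Prop :=
  (n < k ∧ r = n) ∨ (k ≤ n ∧ ∃ i, n ≤ 2 ^ i ∧ (i = 0 ∨ 2 ^ (i - 1) < n) ∧ r = 12 * k * (i + k))

theorem IsBullEFree.refutable {G : SimpleGraph (Fin n)} {L : Fin n → Finset (Fin k)}
    (hG : IsBullEFree G) (hk : 0 < k) {r : ℕ} (hr : IsDepth n k r)
    (hL : ¬ ∃ f, IsListColoring G L f) : Refutable G r L := by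
  obtain ⟨h1, h2⟩ := hG.refutable_of_not_exists hk hL
  rcases hr with ⟨-, rfl⟩ | ⟨-, i, hi, -, rfl⟩
  · exact h1
  · exact h2 i hi

/-- Add the content of `reg 17` to `reg 13` until the powers of two in `reg 15` exceed `reg 2`. -/
def doublingProg : Prog := .loop 16 (straight [.add 15 15 15, .add 13 13 17, .sub 16 2 15])

/-- Register 13 holds the depth plus one, the number of digits that the table needs. Rounding n up
to a power of two by doubling replaces the computation of a logarithm. -/
theorem runs_doublingProg (d : ℕ) : ∀ (i : ℕ) (s : State), s.reg 2 = n → s.reg 17 = 12 * k →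
    s.reg 15 = 2 ^ i → s.reg 16 = n - 2 ^ i → n - 2 ^ i = d → (i = 0 ∨ 2 ^ (i - 1) < n) →
    s.reg 13 = 12 * k * (i + k) + 1 → Runs doublingProg s (5 * d + 1) fun s' =>
      Keep 13 s s' ∧ s'.mem = s.mem ∧ ∃ j, n ≤ 2 ^ j ∧ (j = 0 ∨ 2 ^ (j - 1) < n) ∧
        s'.reg 13 = 12 * k * (j + k) + 1 := by
  induction d using Nat.strong_induction_on with
  | _ d ih =>
    intro i s h2 h17 h15 h16 hd hi h13
    have hpos : 0 < 2 ^ i := by positivity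
    by_cases hle : n ≤ 2 ^ i
    · exact Runs.loop_false (by omega) ⟨Keep.refl _ _, rfl, i, hle, hi, h13⟩ (by omega)
    have hpow : 2 ^ (i + 1) = 2 ^ i + 2 ^ i := by ring
    refine (Runs.loop_true (T := 4) (T' := 5 * (n - 2 ^ (i + 1)) + 1) (by omega)
      (runs_straight ?_ (by simp))).mono (by omega) fun _ h => h
    set s₁ := runList [.add 15 15 15, .add 13 13 17, .sub 16 2 15] s with hs₁
    have hk₁ : Keep 13 s s₁ := by
      simp only [hs₁, runList, Instr.run]
      exact (((Keep.refl _ _).setReg (by decide) _).setReg (by decide) _).setReg (by decide) _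
    have e15 : s₁.reg 15 = 2 ^ (i + 1) := by simp [hs₁, runList, Instr.run, h15, hpow]
    have e16 : s₁.reg 16 = n - 2 ^ (i + 1) := by simp [hs₁, runList, Instr.run, h15, hpow, h2]
    have e17 : s₁.reg 17 = 12 * k := by simp [hs₁, runList, Instr.run, h17]
    have e13 : s₁.reg 13 = 12 * k * (i + 1 + k) + 1 := by
      simp [hs₁, runList, Instr.run, h13, h17]; ring
    have m₁ : s₁.mem = s.mem := rfl
    clear_value s₁
    refine (ih (n - 2 ^ (i + 1)) (by omega) (i + 1) s₁ (by rw [hk₁ 2 (by decide), h2]) e17 e15 e16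
      rfl (Or.inr (by simpa using hle)) e13).mono le_rfl ?_
    rintro s₂ ⟨h3, h4, h5⟩
    exact ⟨hk₁.trans h3 le_rfl, h4.trans m₁, h5⟩

variable (k) in
/-- Compute the number of digits for the table. -/
def depthProg : Prog :=
  .seq (straight [.sub 14 3 2]) (.ite 14 (straight [.add 13 2 1])
    (.seq (straight [.const 13 (12 * k * (0 + k) + 1), .const 15 1, .const 17 (12 * k),
      .sub 16 2 15]) doublingProg))

theorem runs_depthProg {T : ℕ} {s : State} (hs : Ready n k T s) :
    Runs (depthProg k) s (5 * n + 9) fun s' =>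
      Keep 13 s s' ∧ s'.mem = s.mem ∧ ∃ r, IsDepth n k r ∧ s'.reg 13 = r + 1 := by
  refine (Runs.seq (T := 2) (T' := 5 + (5 * n + 1) + 1)
    (runs_straight ?_ (by simp))).mono (by omega) fun _ h => h
  simp only [runList, Instr.run, hs.card, hs.colors]
  refine Runs.ite (fun h14 => runs_straight ?_ (by simp; omega)) fun h14 => ?_
  · refine ⟨((Keep.refl _ _).setReg (by decide) _).setReg (by decide) _, rfl, n, Or.inl ⟨?_, rfl⟩, ?_⟩
    · simp at h14; omega
    · simp [runList, Instr.run, hs.card, hs.one]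
  · have hkn : k ≤ n := by simp at h14; omega
    refine Runs.seq (runs_straight ?_ (by simp))
    set s₁ := runList [.const 13 (12 * k * (0 + k) + 1), .const 15 1, .const 17 (12 * k),
      .sub 16 2 15] (s.setReg 14 (k - n)) with hs₁
    have hk₁ : Keep 13 s s₁ := by
      simp only [hs₁, runList, Instr.run]
      exact (((((Keep.refl _ _).setReg (by decide) _).setReg (by decide) _).setReg (by decide)
        _).setReg (by decide) _).setReg (by decide) _
    have e13 : s₁.reg 13 = 12 * k * (0 + k) + 1 := by simp [hs₁, runList, Instr.run]
    have e15 : s₁.reg 15 = 2 ^ 0 := by simp [hs₁, runList, Instr.run]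
    have e16 : s₁.reg 16 = n - 2 ^ 0 := by simp [hs₁, runList, Instr.run, hs.card]
    have e17 : s₁.reg 17 = 12 * k := by simp [hs₁, runList, Instr.run]
    have m₁ : s₁.mem = s.mem := rfl
    clear_value s₁
    refine (runs_doublingProg (n := n) (k := k) _ 0 s₁ (by rw [hk₁ 2 (by decide), hs.card]) e17 e15
      e16 rfl (Or.inl rfl) e13).mono (by omega) ?_
    rintro s₂ ⟨h1, h2, j, h3, h4, h5⟩
    exact ⟨hk₁.trans h1 le_rfl, h2.trans m₁, _, Or.inr ⟨hkn, j, h3, h4, rfl⟩, h5⟩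

/-- `reg 7 := reg 4 ^ reg 13` -/
def powerProg : Prog :=
  .seq (straight [.const 7 1]) (forLoop 18 13 19 (.seq (mul 20 7 4 21) (straight [.add 7 20 0])))

/-- Resetting register 7 in the conclusion expresses that it is the only constant that changes. -/
theorem runs_powerProg {T e : ℕ} {s : State} (hs : Ready n k T s) (he : s.reg 13 = e) :
    Runs powerProg s (e * (4 * ((n + 1) * k) + 10) + 6) fun s' =>
      Keep 10 s (s'.setReg 7 (s.reg 7)) ∧ s'.mem = s.mem ∧ s'.reg 7 = ((n + 1) * k) ^ e := by
  refine (Runs.seq (T := 2) (T' := e * (4 * ((n + 1) * k) + 4 + 2 + 4) + 4)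
    (runs_straight ?_ (by simp))).mono (by ring_nf; omega) fun _ h => h
  simp only [runList, Instr.run]
  refine runs_forLoop (fun j s' => Keep 10 s (s'.setReg 7 (s.reg 7)) ∧ s'.mem = s.mem ∧
    s'.reg 7 = ((n + 1) * k) ^ j) (by decide) (by decide) (by decide) (by simpa using he) ?_ ?_
    fun _ h => h
  · refine ⟨fun i hi => ?_, rfl, by simp⟩
    simp only [State.setReg_reg]
    split_ifs <;> first | omega | simp_all
  · rintro j - s₁ ⟨hk₁, hm₁, h7⟩ h18 h13
    have e₁ : ∀ i, i < 10 → i ≠ 7 → s₁.reg i = s.reg i := fun i hi h => by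
      rw [← hk₁ i (by omega), State.setReg_reg, if_neg h]
    have e4 : s₁.reg 4 = (n + 1) * k := by rw [e₁ 4 (by decide) (by decide), hs.base]
    have e1 : s₁.reg 1 = 1 := by rw [e₁ 1 (by decide) (by decide), hs.one]
    have e0 : s₁.reg 0 = 0 := by rw [e₁ 0 (by decide) (by decide), hs.zero]
    refine Runs.seq (T := 4 * ((n + 1) * k) + 4) (T' := 2)
      (runs_mul (by decide) (by decide) e0 e1 ?_ (by rw [e4]))
    refine runs_straight ?_ (by simp)
    simp only [runList, Instr.run]
    refine ⟨by simp [h18], by simp [h13], by simp [e1], fun x => ⟨fun i hi => ?_, hm₁, ?_⟩⟩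
    · have := hk₁ i hi
      simp only [State.setReg_reg] at this ⊢
      split_ifs at this ⊢ <;> omega
    · simp [h7, e4, e0, pow_succ]

variable (k) in
/-- The program for List `k`-Coloring. -/
def listColoringProg : Prog :=
  .seq (initProg k) (.seq (depthProg k) (.seq powerProg answerProg))

/-- The time of `listColoringProg` with a table of length `((n + 1) * k) ^ e`. -/
def totalCost (n k e : ℕ) : ℕ :=
  8 * k + 9 * n + e * (4 * ((n + 1) * k) + 10) + 36 + answerCost n k (((n + 1) * k) ^ e)

theorem runs_listColoringProg {G : SimpleGraph (Fin n)} (L : Fin n → Finset (Fin k))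
    (hG : IsBullEFree G) (hk : 0 < k) : ∃ (r t : ℕ) (s : State), IsDepth n k r ∧
      Exec (listColoringProg k) (input G L) t s ∧ t ≤ totalCost n k (r + 1) ∧
        IsCorrectOutput G L s := by
  obtain ⟨t₁, s₁, x₁, ht₁, hr₁, h6, hm₁⟩ := runs_initProg G L
  obtain ⟨t₂, s₂, x₂, ht₂, hk₂, hm₂, r, hr, h13⟩ := runs_depthProg hr₁
  have hr₂ := hr₁.keep hk₂ (by decide)
  obtain ⟨t₃, s₃, x₃, ht₃, hk₃, hm₃, h7⟩ := runs_powerProg hr₂ h13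
  have e₃ : ∀ i, i < 10 → i ≠ 7 → s₃.reg i = s₂.reg i := fun i hi h => by
    rw [← hk₃ i (by omega), State.setReg_reg, if_neg h]
  have hr₃ : Ready n k (1 + n * n + n * k) s₃ := by
    obtain ⟨f0, f1, f2, f3, f4, f5, f9⟩ := hr₂
    constructor <;> rw [e₃ _ (by decide) (by decide)] <;> assumption
  have hm : s₃.mem = inputMem G L := by rw [hm₃, hm₂, hm₁]
  obtain ⟨t₄, s₄, x₄, ht₄, hout⟩ := runs_answerProg (G := G) (L := L) hk le_rfl
    (fun L' hL' => hG.refutable hk hr hL') hr₃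
    (by rw [e₃ 6 (by decide) (by decide), hk₂ 6 (by decide), h6]) h7
    (by rw [hm]; exact encodes_inputMem G L) (by rw [hm]; exact inputMem_eq_zero G L)
  exact ⟨r, _, s₄, hr, x₁.seq (x₂.seq (x₃.seq x₄)), by unfold totalCost; omega, hout⟩

end ListColoring

/-! ### The running time -/

namespace ListColoring

open RAM

variable {n k : ℕ}

/-- Write B for b^e. Applying the rules once costs O(B), a sweep O(B²), closing the table O(B³), and
the at most nk + 1 closures O(B⁴). Since B ≥ 9, three further powers of B absorb the constants. -/
theorem totalCost_le (hn : 2 ≤ n) (hk : 3 ≤ k) (e : ℕ) (he : e ≠ 0) :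
    totalCost n k e ≤ (((n + 1) * k) ^ e) ^ 7 := by
  set b := (n + 1) * k with hb
  set B := b ^ e with hB
  have hb9 : 9 ≤ b := Nat.mul_le_mul (show 3 ≤ n + 1 by omega) hk
  have hbB : b ≤ B := Nat.le_self_pow he b
  have heB : e ≤ B := (Nat.lt_pow_self (by omega : 1 < b)).le
  have hnk : n * k + k = b := by rw [hb]; ring
  have hnn : n ≤ n * k := Nat.le_mul_of_pos_right _ (by omega)
  have hbody : bodyCost n k B ≤ 65 * B := by
    unfold bodyCost
    rw [← hb, show n * (k * 10 + 13) = 10 * (n * k) + 13 * n by ring]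
    omega
  clear_value B b
  have h9 : 9 ≤ B := by omega
  have hS : B * (bodyCost n k B + 4) + 7 ≤ 66 * B ^ 2 := by nlinarith
  have hsolve : solveCost n k B ≤ 80 * B ^ 3 := by
    unfold solveCost
    rw [show n * (k * 10 + 13) = 10 * (n * k) + 13 * n by ring]
    have h1 := Nat.mul_le_mul_left (B + 1) hS
    have h2 : 9 * B ^ 2 ≤ B ^ 3 := by rw [pow_succ B 2]; nlinarith
    have h3 : 9 * B ≤ B ^ 2 := by nlinarith
    have h4 : (B + 1) * (66 * B ^ 2) = 66 * B ^ 3 + 66 * B ^ 2 := by ring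
    omega
  have p2 : 9 * B ≤ B ^ 2 := by nlinarith
  have p3 : 9 * B ^ 2 ≤ B ^ 3 := by rw [pow_succ B 2]; nlinarith
  have p4 : 9 * B ^ 3 ≤ B ^ 4 := by rw [pow_succ B 3]; nlinarith
  have p7 : 729 * B ^ 4 ≤ B ^ 7 := by
    have : 9 ^ 3 ≤ B ^ 3 := Nat.pow_le_pow_left h9 3
    rw [show B ^ 7 = B ^ 3 * B ^ 4 by ring]
    exact Nat.mul_le_mul_right _ this
  have hnkB : n * k ≤ B := by omega
  have q1 : n * k * (solveCost n k B + 14) ≤ B * (80 * B ^ 3 + 14) :=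
    Nat.mul_le_mul hnkB (by omega)
  have q2 : n * k * (6 * (n * k) + 20) ≤ B * (6 * B + 20) := Nat.mul_le_mul hnkB (by omega)
  have q3 : e * (4 * b + 10) ≤ B * (4 * B + 10) := Nat.mul_le_mul heB (by omega)
  have r1 : B * (80 * B ^ 3 + 14) = 80 * B ^ 4 + 14 * B := by ring
  have r2 : B * (6 * B + 20) = 6 * B ^ 2 + 20 * B := by ring
  have r3 : B * (4 * B + 10) = 4 * B ^ 2 + 10 * B := by ring
  unfold totalCost answerCost
  rw [← hb, ← hB]
  omega

theorem pow_depth_le (hn : 2 ≤ n) (hk : 3 ≤ k) {r : ℕ} (hr : IsDepth n k r) :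
    (((((n + 1) * k) ^ (r + 1)) ^ 7 : ℕ) : ℝ) ≤
      (n : ℝ) ^ (525 * (k : ℝ) ^ 2 * Real.logb 2 n) := by
  have hn' : (2 : ℝ) ≤ n := by exact_mod_cast hn
  have hk' : (3 : ℝ) ≤ k := by exact_mod_cast hk
  have hl : 1 ≤ Real.logb 2 n := by
    rw [Real.le_logb_iff_rpow_le (by norm_num) (by linarith)]
    simpa using hn'
  suffices ∃ m : ℕ, (((n + 1) * k) ^ (r + 1)) ^ 7 ≤ n ^ m ∧
      (m : ℝ) ≤ 525 * (k : ℝ) ^ 2 * Real.logb 2 n by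
    obtain ⟨m, h1, h2⟩ := this
    calc (((((n + 1) * k) ^ (r + 1)) ^ 7 : ℕ) : ℝ) ≤ ((n ^ m : ℕ) : ℝ) := by exact_mod_cast h1
      _ = (n : ℝ) ^ (m : ℝ) := by rw [Real.rpow_natCast]; push_cast; rfl
      _ ≤ _ := Real.rpow_le_rpow_of_exponent_le (by linarith) h2
  rcases hr with ⟨hnk, rfl⟩ | ⟨hkn, i, -, hi, rfl⟩
  -- Here n < k, so the base is at most (2^k)² and there are at most k digits; the seventh power
  -- gives 2^(14k²).
  · refine ⟨14 * k ^ 2, ?_, ?_⟩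
    · have h1 : (r + 1) * k ≤ (2 ^ k) ^ 2 := by
        rw [pow_two]
        exact Nat.mul_le_mul (Nat.succ_le_of_lt (hnk.trans Nat.lt_two_pow_self)) Nat.lt_two_pow_self.le
      calc (((r + 1) * k) ^ (r + 1)) ^ 7 ≤ (((2 ^ k) ^ 2) ^ k) ^ 7 :=
            Nat.pow_le_pow_left ((Nat.pow_le_pow_left h1 _).trans
              (Nat.pow_le_pow_right (by positivity) hnk)) _
        _ = 2 ^ (14 * k ^ 2) := by rw [← pow_mul, ← pow_mul, ← pow_mul]; ring_nf
        _ ≤ r ^ (14 * k ^ 2) := Nat.pow_le_pow_left hn _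
    · push_cast
      nlinarith [sq_nonneg (k : ℝ)]
  -- The factor 21 is 7 · 3: the seventh power from the cost, and the base (n + 1)k ≤ n³ for k ≤ n.
  · refine ⟨21 * (12 * k * (i + k) + 1), ?_, ?_⟩
    · have h1 : (n + 1) * k ≤ n ^ 3 := by
        calc (n + 1) * k ≤ n ^ 2 * n := Nat.mul_le_mul (by nlinarith) hkn
          _ = n ^ 3 := by ring
      calc (((n + 1) * k) ^ (12 * k * (i + k) + 1)) ^ 7
          ≤ ((n ^ 3) ^ (12 * k * (i + k) + 1)) ^ 7 :=
            Nat.pow_le_pow_left (Nat.pow_le_pow_left h1 _) _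
        _ = n ^ (21 * (12 * k * (i + k) + 1)) := by rw [← pow_mul, ← pow_mul]; ring_nf
    · have hi' : (i : ℝ) ≤ 2 * Real.logb 2 n := by
        rcases i with _ | i
        · simp; linarith
        · have h2 : (2 : ℝ) ^ i ≤ n := by
            have := hi.resolve_left (by omega)
            rw [Nat.add_sub_cancel] at this
            exact_mod_cast this.le
          have : (i : ℝ) ≤ Real.logb 2 n := by
            rw [Real.le_logb_iff_rpow_le (by norm_num) (by linarith), Real.rpow_natCast]
            exact h2
          push_cast
          linarith
      push_cast
      set l := Real.logb 2 n
      -- With l the logarithm of n, each of ki, k² and 1 is at most k²l, so 12k(i + k) + 1 ≤ 25k²l,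
      -- and 21 · 25 = 525.
      have h3 : (k : ℝ) * i ≤ k * (2 * l) := mul_le_mul_of_nonneg_left hi' (by linarith)
      have h4 : 2 * (k * l) ≤ (k : ℝ) ^ 2 * l := by
        have : 2 * (k : ℝ) ≤ k ^ 2 := by nlinarith
        nlinarith
      have h5 : (k : ℝ) ^ 2 ≤ k ^ 2 * l := le_mul_of_one_le_right (by positivity) hl
      have h6 : (1 : ℝ) ≤ k ^ 2 := by nlinarith
      nlinarith

end ListColoring

theorem mainTheorem5 :
    ∃ C : ℕ, ∀ k : ℕ, 3 ≤ k →
      ∃ P : RAM.Prog, ∀ (n : ℕ) (G : SimpleGraph (Fin n)) (L : Fin n → Finset (Fin k)),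
        ListColoring.IsBullEFree G →
          ∃ (t : ℕ) (s : RAM.State),
            RAM.Exec P (ListColoring.input G L) t s ∧
            ListColoring.IsCorrectOutput G L s ∧
            (2 ≤ n → (t : ℝ) ≤ (n : ℝ) ^ ((C : ℝ) * (k : ℝ) ^ 2 * Real.logb 2 (n : ℝ))) := by
  refine ⟨525, fun k hk => ⟨ListColoring.listColoringProg k, fun n G L hG => ?_⟩⟩
  obtain ⟨r, t, s, hr, hx, ht, hout⟩ :=
    ListColoring.runs_listColoringProg L hG (by omega)
  refine ⟨t, s, hx, hout, fun hn => ?_⟩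
  have h1 : (t : ℝ) ≤ (((((n + 1) * k) ^ (r + 1)) ^ 7 : ℕ) : ℝ) := by
    exact_mod_cast ht.trans (ListColoring.totalCost_le hn hk (r + 1) (by omega))
  exact_mod_cast h1.trans (ListColoring.pow_depth_le hn hk hr)
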